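/- Virtual link and tangle diagrams are generic curve diagrams in the plane, respectively in a disc with fixed ends on its boundary, whose double points are classical crossings (with over/under information) or virtual crossings. Let $\delta=-A^2-A^{-2}$. A state $s$ of a diagram $D$ is a choice, at every classical crossing, of the $A$-smoothing or the $A^{-1}$-smoothing (virtual crossings are left as they are); let $a(s)$ and $b(s)$ be the numbers of $A$- and $A^{-1}$-smoothings chosen, and $|s|$ the number of closed curves of the resulting diagram, which has only virtual crossings. The bracket polynomial of a nonempty link diagram $D$ is $$\langle D\rangle=\sum_s A^{a(s)-b(s)}\,\delta^{|s|-1}\in\mathbb Z[A,A^{-1}],$$ so that the crossingless circle has bracket $1$ (and by convention the empty diagram has bracket $1$). The bracket polynomial of a tangle diagram $T$ is the formal $\mathbb Z[A,A^{-1}]$-linear combination $$\langle T\rangle=\sum_s A^{a(s)-b(s)}\,\delta^{|s|}\,[s]$$ of basic tangles, where the basic tangle $[s]$ records which ends are joined by the arcs of $s$. For a tangle with four ends there are three basic tangles: two horizontal strands, two vertical strands, and a single virtual crossing. A \emph{flype} replaces a four-ended virtual tangle $P$, contained in a diagram, by $X+P'+\overline X$, where $P'$ is $P$ rotated in space by a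 half turn about its horizontal axis, $+$ places tangles side by side, $X$ is a single crossing and $\overline X$ is the opposite crossing; equivalently up to cancelling a pair of adjacent crossings, it replaces $X+P$ by $P'+X$. (The horizontal direction here may be any direction in the plane.) The flype is \emph{classical} if $X$ is a classical crossing of either sign, and \emph{virtual} if $X=\overline X$ is a virtual crossing. \emph{Regular $F$-equivalence} is the equivalence relation on diagrams generated by planar isotopy (rel ends), the Reidemeister moves II and III, the virtual Reidemeister moves (the moves I*, II*, III* on virtual crossings, and the mixed move in which a strand with two virtual crossings passes a classical crossing), and classical and virtual flypes. \textbf{Theorem.} The bracket polynomial of virtual links (in particular knots) and of virtual tangles is unchanged by classical and virtual flypes. Moreover it is an invariant of regular $F$-equivalence: if two virtual link diagrams, or two virtual tangle diagrams with the same ends, are regularly $F$-equivalent, then their bracket polynomials are equal. -/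

import Mathlib

/-!
Virtual link and tangle diagrams, in Morse position.

A diagram is read from left to right.  It is a finite sequence of elementary slices; a slice
contains exactly one crossing, one right-hand turn `⊃` or one left-hand turn `⊂`, together with
some horizontal strands below it and some above it.  The strands at each level are numbered
`0, 1, 2, …` from bottom to top.  A diagram in `Diagram m n` has `m` ends on its left side and `n`
ends on its right side; four-ended tangles are the elements of `Diagram 2 2`, and link diagrams
are the elements of `Diagram 0 0`.
-/

namespace VirtualTangle

/-- The kinds of crossing.  At `pos` the strand from bottom left to top right passes over, at `neg`
the strand from top left to bottom right passes over, and `virt` is a virtual crossing. -/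
inductive Crossing
  | pos
  | neg
  | virt
  deriving DecidableEq

/-- The crossing with over and under exchanged; a virtual crossing is unchanged.  This is also what
a crossing becomes when it is rotated by a quarter turn in the plane, or reflected in a line of the
plane perpendicular or parallel to the reading direction. -/
def Crossing.opp : Crossing → Crossing
  | .pos => .neg
  | .neg => .pos
  | .virt => .virt

/-- The elementary pieces: a crossing, the turn `⊃` (two strands on the left, none on the right)
and the turn `⊂` (none on the left, two on the right). -/
inductive Piece
  | crossing (c : Crossing)
  | cap
  | cup
  deriving DecidableEq

/-- Number of ends of a piece on its left. -/
def Piece.ins : Piece → ℕ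
  | .crossing _ => 2
  | .cap => 2
  | .cup => 0

/-- Number of ends of a piece on its right. -/
def Piece.outs : Piece → ℕ
  | .crossing _ => 2
  | .cap => 0
  | .cup => 2

/-- A slice: one piece with `below` horizontal strands under it and `above` horizontal strands over
it (all of them disjoint from the piece). -/
structure Slice where
  below : ℕ
  piece : Piece
  above : ℕ
  deriving DecidableEq

/-- Number of strands on the left of a slice. -/
def Slice.source (s : Slice) : ℕ := s.below + s.piece.ins + s.above

/-- Number of strands on the right of a slice. -/
def Slice.target (s : Slice) : ℕ := s.below + s.piece.outs + s.above

/-- `IsWord m n w`: the slices of `w` fit together to a diagram with `m` left ends and `n` right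
ends. -/
def IsWord : ℕ → ℕ → List Slice → Prop
  | m, n, [] => m = n
  | m, n, s :: w => s.source = m ∧ IsWord s.target n w

/-- Virtual tangle diagrams with `m` ends on the left and `n` ends on the right. -/
structure Diagram (m n : ℕ) where
  word : List Slice
  isWord : IsWord m n word

/-- Virtual link (in particular, knot) diagrams: diagrams without ends. -/
abbrev LinkDiagram : Type := Diagram 0 0

/-- Add `i` horizontal strands below and `j` horizontal strands above a diagram. -/
def pad (i j : ℕ) (w : List Slice) : List Slice :=
  w.map fun s => ⟨i + s.below, s.piece, s.above + j⟩

/-- Rotation of a diagram in space by a half turn about its horizontal axis (the tangle is flipped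
upside down).  The plane is reflected top to bottom and over and under are exchanged; the
composite of the two maps each single crossing to itself and reverses the order of the strands. -/
def flip (w : List Slice) : List Slice :=
  w.map fun s => ⟨s.above, s.piece, s.below⟩

/-! ### The moves -/

/-- A single crossing, as a slice with `i` strands below and `j` strands above. -/
def cr (i : ℕ) (c : Crossing) (j : ℕ) : Slice := ⟨i, .crossing c, j⟩

/-- Planar isotopy of diagrams in Morse position: exchange of the left-to-right
order of two pieces one of which lies above the other, straightening of a strand, and passage of a crossing through a turn. -/
inductive PlanarIsotopyMove : List Slice → List Slice → Prop
  | exchange (g h : Piece) (k : ℕ) : PlanarIsotopyMove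
      [⟨0, g, k + h.ins⟩, ⟨g.outs + k, h, 0⟩] [⟨g.ins + k, h, 0⟩, ⟨0, g, k + h.outs⟩]
  | zigzag_up : PlanarIsotopyMove [⟨1, .cup, 0⟩, ⟨0, .cap, 1⟩] []
  | zigzag_down : PlanarIsotopyMove [⟨0, .cup, 1⟩, ⟨1, .cap, 0⟩] []
  | slide_cap (c : Crossing) :
      PlanarIsotopyMove [cr 0 c 1, ⟨1, .cap, 0⟩] [cr 1 c.opp 0, ⟨0, .cap, 1⟩]
  | slide_cup (c : Crossing) :
      PlanarIsotopyMove [⟨1, .cup, 0⟩, cr 0 c 1] [⟨0, .cup, 1⟩, cr 1 c.opp 0]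

/-- Three strands `0, 1, 2` crossing pairwise: `0` and `1` cross at `a`, `0` and `2` cross at `b`,
`1` and `2` cross at `c`, in this order from left to right. -/
def triangle (a b c : Crossing) : List Slice := [cr 0 a 1, cr 1 b 0, cr 0 c 1]

/-- The same three strands with the same crossings after one strand has been moved across the
crossing of the two others. -/
def triangle' (a b c : Crossing) : List Slice := [cr 1 c 0, cr 0 b 1, cr 1 a 0]

/-- The classical Reidemeister moves II and III.  In move III the side condition says that one of
the three strands lies over the two others and one lies under the two others. -/
inductive RegularMove : List Slice → List Slice → Prop
  | two (c : Crossing) (hc : c ≠ .virt) : RegularMove [cr 0 c 0, cr 0 c.opp 0] []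
  | three (a b c : Crossing) (ha : a ≠ .virt) (hb : b ≠ .virt) (hc : c ≠ .virt)
      (h : a = c → b = a) : RegularMove (triangle a b c) (triangle' a b c)

/-- The virtual Reidemeister moves I*, II*, III*, and the mixed move, in which a strand with two
virtual crossings passes across a classical crossing. -/
inductive VirtualMove : List Slice → List Slice → Prop
  | one_cap : VirtualMove [cr 0 .virt 0, ⟨0, .cap, 0⟩] [⟨0, .cap, 0⟩]
  | one_cup : VirtualMove [⟨0, .cup, 0⟩, cr 0 .virt 0] [⟨0, .cup, 0⟩]
  | two : VirtualMove [cr 0 .virt 0, cr 0 .virt 0] []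
  | three : VirtualMove (triangle .virt .virt .virt) (triangle' .virt .virt .virt)
  | mixed_first (c : Crossing) (hc : c ≠ .virt) :
      VirtualMove (triangle c .virt .virt) (triangle' c .virt .virt)
  | mixed_middle (c : Crossing) (hc : c ≠ .virt) :
      VirtualMove (triangle .virt c .virt) (triangle' .virt c .virt)
  | mixed_last (c : Crossing) (hc : c ≠ .virt) :
      VirtualMove (triangle .virt .virt c) (triangle' .virt .virt c)

/-- The flypes: a four-ended tangle `p` is replaced by the tangle `p` flipped upside down, with a
crossing added on its left and the opposite crossing on its right; or `p` is flipped upside down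
and a crossing on its left moves to its right.  The flype is classical if the crossings outside
of `p` are classical, and virtual if they are virtual; `p` may contain crossings of all kinds. -/
inductive FlypeMove : List Slice → List Slice → Prop
  | classical (c : Crossing) (hc : c ≠ .virt) (p : List Slice) (hp : IsWord 2 2 p) :
      FlypeMove p (cr 0 c 0 :: (flip p ++ [cr 0 c.opp 0]))
  | classical_pass (c : Crossing) (hc : c ≠ .virt) (p : List Slice) (hp : IsWord 2 2 p) :
      FlypeMove (cr 0 c 0 :: p) (flip p ++ [cr 0 c 0])
  | virtual (p : List Slice) (hp : IsWord 2 2 p) :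
      FlypeMove p (cr 0 .virt 0 :: (flip p ++ [cr 0 .virt 0]))
  | virtual_pass (p : List Slice) (hp : IsWord 2 2 p) :
      FlypeMove (cr 0 .virt 0 :: p) (flip p ++ [cr 0 .virt 0])

/-- `D` and `D'` coincide outside of a small rectangle, where they differ by the move `M`. -/
def DifferBy (M : List Slice → List Slice → Prop) {m n : ℕ} (D D' : Diagram m n) : Prop :=
  ∃ (u v l r : List Slice) (i j : ℕ), M l r ∧
    D.word = u ++ pad i j l ++ v ∧ D'.word = u ++ pad i j r ++ v

/-- Planar isotopy of diagrams with fixed ends. -/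
def PlanarIsotopic {m n : ℕ} : Diagram m n → Diagram m n → Prop :=
  Relation.EqvGen (DifferBy PlanarIsotopyMove)

/-- `D'` arises from `D` by one classical or virtual flype on a four-ended tangle contained in `D`,
in any position in the plane: the diagrams are considered up to planar isotopy, so the axis of the
flype need not be horizontal. -/
def Flype {m n : ℕ} (D D' : Diagram m n) : Prop :=
  ∃ E E' : Diagram m n, PlanarIsotopic D E ∧ DifferBy FlypeMove E E' ∧ PlanarIsotopic E' D'

/-- One of the moves that generate regular `F`-equivalence. -/
def RegularFMove {m n : ℕ} (D D' : Diagram m n) : Prop :=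
  DifferBy PlanarIsotopyMove D D' ∨ DifferBy RegularMove D D' ∨ DifferBy VirtualMove D D' ∨
    Flype D D'

/-- Regular `F`-equivalence: the equivalence relation generated by planar isotopy (with fixed
ends), the Reidemeister moves II and III, the virtual Reidemeister moves, and all flypes. -/
def RegularFEquivalent {m n : ℕ} : Diagram m n → Diagram m n → Prop :=
  Relation.EqvGen RegularFMove

/-! ### The bracket polynomial -/

/-- The smoothing in which the crossing of `s` is replaced by `⊃⊂`. -/
def turned (s : Slice) : List Slice := [⟨s.below, .cap, s.above⟩, ⟨s.below, .cup, s.above⟩]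

/-- The states of a diagram with their coefficients, obtained from the rule that a classical
crossing is `A` times its `A`-smoothing plus `A⁻¹` times its other smoothing, applied at every
classical crossing.  The `A`-smoothing joins the two regions swept out by the over strand when it
turns counterclockwise: it is `⊃⊂` at `pos`, and a pair of parallel horizontal strands (the slice
is left out) at `neg`.  The variable `A` is `LaurentPolynomial.T 1`. -/
noncomputable def states : List Slice → List (LaurentPolynomial ℤ × List Slice)
  | [] => [(1, [])]
  | s :: w =>
    match s.piece with
    | .crossing .pos =>
        (states w).map (fun x => (LaurentPolynomial.T 1 * x.1, turned s ++ x.2)) ++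
          (states w).map (fun x => (LaurentPolynomial.T (-1) * x.1, x.2))
    | .crossing .neg =>
        (states w).map (fun x => (LaurentPolynomial.T 1 * x.1, x.2)) ++
          (states w).map (fun x => (LaurentPolynomial.T (-1) * x.1, turned s ++ x.2))
    | _ => (states w).map fun x => (x.1, s :: x.2)

/-- The pieces of curve inside a slice at level `t`.  The point `(t, p)` is the `p`-th point from
below on the left side of the slice, and `(t + 1, p)` is the `p`-th point on its right side.  The
two strands through a crossing go straight on. -/
inductive Slice.Arc (s : Slice) (t : ℕ) : ℕ × ℕ → ℕ × ℕ → Prop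
  | below (p : ℕ) (h : p < s.below) : Arc s t (t, p) (t + 1, p)
  | above (p : ℕ) (h : p < s.above) :
      Arc s t (t, s.below + s.piece.ins + p) (t + 1, s.below + s.piece.outs + p)
  | up (c : Crossing) (h : s.piece = .crossing c) : Arc s t (t, s.below) (t + 1, s.below + 1)
  | down (c : Crossing) (h : s.piece = .crossing c) : Arc s t (t, s.below + 1) (t + 1, s.below)
  | cap (h : s.piece = .cap) : Arc s t (t, s.below) (t, s.below + 1)
  | cup (h : s.piece = .cup) : Arc s t (t + 1, s.below) (t + 1, s.below + 1)

/-- Two points of the diagram of `w` are the ends of a piece of curve inside one slice. -/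
def Arc (w : List Slice) (x y : ℕ × ℕ) : Prop :=
  ∃ (t : ℕ) (ht : t < w.length), (w[t]).Arc t x y

/-- Two points lie on the same curve of the diagram of `w`. -/
def sameCurve (w : List Slice) : Setoid (ℕ × ℕ) := Relation.EqvGen.setoid (Arc w)

/-- The ends of a diagram of `w` with `m` ends on the left and `n` ends on the right. -/
def endPoint (m n : ℕ) (w : List Slice) : Fin m ⊕ Fin n → ℕ × ℕ
  | .inl p => (0, p)
  | .inr q => (w.length, q)

/-- How the curves of `w` join the ends.  A diagram without classical crossings and closed curves
is determined by this up to virtual Reidemeister moves; for `m = n = 2` there are the three basic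
tangles (two parallel horizontal strands, the two turns `⊃⊂`, a virtual crossing). -/
def connection (m n : ℕ) (w : List Slice) : Setoid (Fin m ⊕ Fin n) :=
  (sameCurve w).comap (endPoint m n w)

/-- The number of closed curves of `w`: classes of points that contain some arc but no end. -/
noncomputable def loops (m n : ℕ) (w : List Slice) : ℕ :=
  Nat.card {c : Quotient (sameCurve w) //
    (∃ x y, Arc w x y ∧ Quotient.mk (sameCurve w) x = c) ∧
      ∀ e, Quotient.mk (sameCurve w) (endPoint m n w e) ≠ c}

/-- The value `-A ^ 2 - A ^ (-2)` of a closed curve. -/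
noncomputable def loopValue : LaurentPolynomial ℤ :=
  -LaurentPolynomial.T 2 - LaurentPolynomial.T (-2)

/-- The bracket polynomial of a tangle diagram: a formal linear combination, with coefficients in
`ℤ[A, A⁻¹]`, of the basic tangles.  Each state contributes the basic tangle to which it reduces,
times its coefficient, times `-A ^ 2 - A ^ (-2)` for every closed curve. -/
noncomputable def bracket {m n : ℕ} (D : Diagram m n) :
    Setoid (Fin m ⊕ Fin n) →₀ LaurentPolynomial ℤ :=
  ((states D.word).map fun x =>
    Finsupp.single (connection m n x.2) (x.1 * loopValue ^ loops m n x.2)).sum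

/-- The bracket polynomial of a knot or link diagram, normalized to be `1` on the circle without
crossings.  Every state of a nonempty link diagram has a closed curve; on the empty diagram the
value is `1` by convention. -/
noncomputable def linkBracket (D : LinkDiagram) : LaurentPolynomial ℤ :=
  ((states D.word).map fun x => x.1 * loopValue ^ (loops 0 0 x.2 - 1)).sum

end VirtualTangle

/-!
The proof counts colourings of curves with two colours.  Colour the points of a diagram with the two
values of `Bool`, constantly along every curve.  A colouring of the ends extends to the diagram of a
state in `2 ^ loops` ways if it respects the connection of the ends, and in no way otherwise
(`count_transfer_of_connection`).  Hence these numbers determine both the connection and the number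
of closed curves (`connection_eq_and_loops_eq`).  On the other hand they can be computed slice by
slice, as the multiset `transfer w x` of colours which the word `w` produces on its right from the
colours `x` on its left, and `transfer` of a composite diagram is the composite of the transfers.  So
two states may be exchanged inside of any diagram as soon as they have the same transfer
(`IsLocal.context`).  For the local pictures of fixed size this is a finite computation, and for two
pieces above one another it says that their transfers commute (`transfer_exchange`).
Together with the linear relation that defines the states, this gives the invariance under the
Reidemeister moves, the virtual moves and planar isotopy by Kauffman's usual computation.

A flype contains an arbitrary four-ended tangle `p`, but two colours see very little of it: the
transfer commutes with the exchange of the two colours and preserves the parity of the number of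
ends coloured `true`.  On two strands, reversing their order is either trivial (equal colours) or the
exchange of the two colours (different colours).  It follows that the states of `p` and of `p` turned
upside down have the same transfer (`transfer_flip_eq`), and that a state of `p` commutes with `⊃⊂`
(`transfer_turns_comm`); it passes through a virtual crossing when it is turned upside down, since
the crossing reverses the two strands.  By linearity `X + p = p' + X` in the combinations of states,
for a crossing `X` of any kind (`skeinEquiv_flype_pass`), and the other form of the flype follows by
cancelling two opposite crossings.

Finally, the bracket of a nonempty link diagram as a tangle is `-A ^ 2 - A ^ (-2)` times its link
bracket, and that factor can be cancelled; no move changes whether a link diagram is empty.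
-/

namespace VirtualTangle

open LaurentPolynomial (T)

/-! ### Colourings of the points of a diagram with two colours -/

/-- The colours that can occur on the right of a piece, given the colours on its left. -/
def Piece.act : Piece → List Bool → Multiset (List Bool)
  | .crossing _, [p, q] => {[q, p]}
  | .cap, [p, q] => if p = q then {[]} else 0
  | .cup, [] => {[false, false], [true, true]}
  | _, _ => 0

/-- The colours that can occur on the right of a slice, given the colours on its left. -/
def Slice.act (s : Slice) (x : List Bool) : Multiset (List Bool) :=
  (s.piece.act ((x.drop s.below).take s.piece.ins)).map fun z =>
    x.take s.below ++ z ++ x.drop (s.below + s.piece.ins)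

/-- The colours that can occur at the right ends of a word, given the colours at its left ends.
Each occurs as often as there are colourings of the whole diagram that induce it. -/
def transfer : List Slice → List Bool → Multiset (List Bool)
  | [], x => {x}
  | s :: w, x => (s.act x).bind (transfer w)

theorem Slice.act_append (s : Slice) {a b : List Bool} (c : List Bool) (ha : a.length = s.below)
    (hb : b.length = s.piece.ins) :
    s.act (a ++ b ++ c) = (s.piece.act b).map fun z => a ++ z ++ c := by
  have h1 : ((a ++ b ++ c).drop s.below).take s.piece.ins = b := by
    rw [List.append_assoc, List.drop_left' ha, List.take_left' hb]
  have h2 : (a ++ b ++ c).take s.below = a := by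
    rw [List.append_assoc, List.take_left' ha]
  have h3 : (a ++ b ++ c).drop (s.below + s.piece.ins) = c :=
    List.drop_left' (by simp [ha, hb])
  rw [Slice.act, h1, h2, h3]

theorem exists_append_of_length {α : Type*} {x : List α} {i j k : ℕ}
    (h : x.length = i + j + k) :
    ∃ a b c, x = a ++ b ++ c ∧ a.length = i ∧ b.length = j ∧ c.length = k := by
  refine ⟨x.take i, (x.drop i).take j, x.drop (i + j), ?_, ?_, ?_, ?_⟩
  · rw [List.append_assoc, ← List.drop_drop, List.take_append_drop, List.take_append_drop]
  all_goals simp; omega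

theorem Piece.length_of_mem_act {g : Piece} {x z : List Bool} (h : z ∈ g.act x) :
    z.length = g.outs := by
  unfold Piece.act at h
  split at h
  · simp_all [Piece.outs]
  · split_ifs at h <;> simp_all [Piece.outs]
  · simp at h; rcases h with rfl | rfl <;> rfl
  · simp at h

theorem Piece.nodup_act (g : Piece) (x : List Bool) : (g.act x).Nodup := by
  unfold Piece.act
  split
  · simp
  · split_ifs <;> simp
  · simp
  · simp

theorem Slice.nodup_act (s : Slice) (x : List Bool) : (s.act x).Nodup := by
  refine Multiset.Nodup.map (fun z z' h => ?_) (Piece.nodup_act _ _)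
  simpa using h

theorem Slice.length_of_mem_act {s : Slice} {x z : List Bool} (hx : x.length = s.source)
    (h : z ∈ s.act x) : z.length = s.target := by
  obtain ⟨a, b, c, rfl, ha, hb, hc⟩ := exists_append_of_length hx
  rw [s.act_append c ha hb, Multiset.mem_map] at h
  obtain ⟨z, hz, rfl⟩ := h
  simp [Piece.length_of_mem_act hz, Slice.target, ha, hc, add_assoc]

/-- The colouring of the points of a one-slice diagram given by the colours on its two sides. -/
def sides (x z : List Bool) : ℕ × ℕ → Bool
  | (0, p) => x.getD p false
  | (_ + 1, p) => z.getD p false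

theorem Slice.mem_act_iff {s : Slice} {x z : List Bool} (hx : x.length = s.source)
    (hz : z.length = s.target) :
    z ∈ s.act x ↔ ∀ u v, s.Arc 0 u v → sides x z u = sides x z v := by
  obtain ⟨a, b, c, rfl, ha, hb, hc⟩ := exists_append_of_length hx
  obtain ⟨a', b', c', rfl, ha', hb', hc'⟩ := exists_append_of_length hz
  obtain ⟨i, g, j⟩ := s
  dsimp only at *
  subst hc' ha'
  have key : (a' ++ b' ++ c' ∈ Slice.act ⟨a'.length, g, c'.length⟩ (a ++ b ++ c)) ↔
      a = a' ∧ b' ∈ g.act b ∧ c = c' := by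
    rw [Slice.act_append _ c ha hb, Multiset.mem_map]
    constructor
    · rintro ⟨d, hd, h⟩
      have hl := Piece.length_of_mem_act hd
      obtain ⟨h1, h2⟩ := List.append_inj h (by simp [ha, hl, hb'])
      obtain ⟨h3, h4⟩ := List.append_inj h1 (by simp [ha])
      subst h4
      exact ⟨h3, hd, h2⟩
    · rintro ⟨rfl, h, rfl⟩
      exact ⟨_, h, rfl⟩
  rw [key]
  have gl : ∀ (a b c : List Bool) (p : ℕ), p < a.length →
      (a ++ b ++ c).getD p false = a.getD p false := by
    intro a b c p h
    rw [List.append_assoc, List.getD_append _ _ _ _ h]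
  have gm : ∀ (a b c : List Bool) (p n : ℕ), a.length = n → p < b.length →
      (a ++ b ++ c).getD (n + p) false = b.getD p false := by
    rintro a b c p n rfl h
    rw [List.append_assoc, List.getD_append_right _ _ _ _ (by omega),
      List.getD_append _ _ _ _ (by omega)]
    congr 1; omega
  have gr : ∀ (a b c : List Bool) (p n k : ℕ), a.length = n → b.length = k →
      (a ++ b ++ c).getD (n + k + p) false = c.getD p false := by
    rintro a b c p n k rfl rfl
    rw [List.getD_append_right _ _ _ _ (by simp)]
    congr 1; simp
  have ext : ∀ (a b : List Bool), a.length = b.length →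
      (∀ p < a.length, a.getD p false = b.getD p false) → a = b := by
    intro a b h h'
    refine List.ext_getElem h fun p h1 h2 => ?_
    simpa [h1, h2] using h' p h1
  constructor
  · rintro ⟨rfl, hm, rfl⟩ u v huv
    cases huv with
    | below p h => simp only [sides]; dsimp only at h; rw [gl _ _ _ _ h, gl _ _ _ _ h]
    | above p h => simp only [sides]; rw [gr _ _ _ _ _ _ rfl hb, gr _ _ _ _ _ _ rfl hb']
    | up k h =>
      dsimp only at h; subst h
      obtain ⟨p, q, rfl⟩ := List.length_eq_two.1 hb
      simp only [Piece.act, Multiset.mem_singleton] at hm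
      subst hm
      simp [sides]
    | down k h =>
      dsimp only at h; subst h
      obtain ⟨p, q, rfl⟩ := List.length_eq_two.1 hb
      simp only [Piece.act, Multiset.mem_singleton] at hm
      subst hm
      simp [sides]
    | cap h =>
      dsimp only at h; subst h
      obtain ⟨p, q, rfl⟩ := List.length_eq_two.1 hb
      simp only [Piece.act] at hm
      split_ifs at hm with hpq
      · subst hpq; simp [sides]
      · simp at hm
    | cup h =>
      dsimp only at h; subst h
      obtain rfl := List.length_eq_zero_iff.1 hb
      simp only [Piece.act, Multiset.insert_eq_cons, Multiset.mem_cons,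
        Multiset.mem_singleton] at hm
      rcases hm with rfl | rfl <;> simp [sides]
  · intro H
    refine ⟨ext _ _ ha fun p hp => ?_, ?_, ext _ _ hc fun p hp => ?_⟩
    · have := H _ _ (Slice.Arc.below p (by dsimp only at *; omega))
      simp only [sides] at this
      rwa [gl _ _ _ _ hp, gl _ _ _ _ (by omega)] at this
    · cases g with
      | crossing k =>
        have h1 := H _ _ (Slice.Arc.up k rfl)
        have h2 := H _ _ (Slice.Arc.down k rfl)
        obtain ⟨p, q, rfl⟩ := List.length_eq_two.1 hb
        obtain ⟨p', q', rfl⟩ := List.length_eq_two.1 hb'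
        simp [sides, ← ha] at h1
        simp [sides, ha] at h1 h2
        simp [Piece.act, h1, h2]
      | cap =>
        have h1 := H _ _ (Slice.Arc.cap rfl)
        obtain ⟨p, q, rfl⟩ := List.length_eq_two.1 hb
        obtain rfl := List.length_eq_zero_iff.1 hb'
        simp [sides, ← ha] at h1
        simp [Piece.act, h1]
      | cup =>
        have h1 := H _ _ (Slice.Arc.cup rfl)
        obtain ⟨p, q, rfl⟩ := List.length_eq_two.1 hb'
        obtain rfl := List.length_eq_zero_iff.1 hb
        simp [sides] at h1
        subst h1
        cases p <;> simp [Piece.act]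
    · have := H _ _ (Slice.Arc.above p (by dsimp only at *; omega))
      simp only [sides] at this
      rwa [gr _ _ _ _ _ _ ha hb, gr _ _ _ _ _ _ rfl hb'] at this

theorem length_of_mem_transfer {m n : ℕ} {w : List Slice} (hw : IsWord m n w) {x z : List Bool}
    (hx : x.length = m) (h : z ∈ transfer w x) : z.length = n := by
  induction w generalizing m x with
  | nil => simp only [transfer, Multiset.mem_singleton] at h; rw [h, hx]; exact hw
  | cons s w ih =>
    obtain ⟨h1, h2⟩ := hw
    rw [transfer, Multiset.mem_bind] at h
    obtain ⟨y, hy, h⟩ := h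
    exact ih h2 (Slice.length_of_mem_act (hx.trans h1.symm) hy) h

/-! ### Colourings that are constant along the curves -/

/-- The number of points at level `t` of a word with `m` left ends. -/
def level : ℕ → List Slice → ℕ → ℕ
  | m, _, 0 => m
  | _, [], _ + 1 => 0
  | _, s :: w, t + 1 => level s.target w t

/-- The colourings of the points of a diagram that are constant along the curves and restrict to
`x` on the left and to `y` on the right ends.  The pairs that are not points get the value
`false`. -/
structure IsColouring (m : ℕ) (w : List Slice) (x y : List Bool) (f : ℕ × ℕ → Bool) : Prop where
  arc : ∀ u v, Arc w u v → f u = f v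
  supp : ∀ t p, level m w t ≤ p → f (t, p) = false
  left : ∀ p, f (0, p) = x.getD p false
  right : ∀ p, f (w.length, p) = y.getD p false

theorem Slice.arc_succ {s : Slice} {t : ℕ} {u v : ℕ × ℕ} :
    s.Arc (t + 1) u v ↔ ∃ u' v', s.Arc t u' v' ∧ u = (u'.1 + 1, u'.2) ∧ v = (v'.1 + 1, v'.2) := by
  constructor
  · intro h
    cases h with
    | below p h => exact ⟨_, _, .below p h, rfl, rfl⟩
    | above p h => exact ⟨_, _, .above p h, rfl, rfl⟩
    | up c h => exact ⟨_, _, .up c h, rfl, rfl⟩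
    | down c h => exact ⟨_, _, .down c h, rfl, rfl⟩
    | cap h => exact ⟨_, _, .cap h, rfl, rfl⟩
    | cup h => exact ⟨_, _, .cup h, rfl, rfl⟩
  · rintro ⟨u', v', h, rfl, rfl⟩
    cases h with
    | below p h => exact .below p h
    | above p h => exact .above p h
    | up c h => exact .up c h
    | down c h => exact .down c h
    | cap h => exact .cap h
    | cup h => exact .cup h

theorem arc_cons {s : Slice} {w : List Slice} {u v : ℕ × ℕ} :
    Arc (s :: w) u v ↔ s.Arc 0 u v ∨
      ∃ u' v', Arc w u' v' ∧ u = (u'.1 + 1, u'.2) ∧ v = (v'.1 + 1, v'.2) := by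
  constructor
  · rintro ⟨t, ht, h⟩
    cases t with
    | zero => exact .inl h
    | succ t =>
      obtain ⟨u', v', h, e⟩ := Slice.arc_succ.1 h
      exact .inr ⟨u', v', ⟨t, by simpa using ht, h⟩, e⟩
  · rintro (h | ⟨u', v', ⟨t, ht, h⟩, e⟩)
    · exact ⟨0, by simp, h⟩
    · exact ⟨t + 1, by simpa using ht, Slice.arc_succ.2 ⟨u', v', h, e⟩⟩

theorem Slice.arc_zero_fst {s : Slice} {u v : ℕ × ℕ} (h : s.Arc 0 u v) : u.1 ≤ 1 ∧ v.1 ≤ 1 := by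
  cases h <;> simp

/-- Prepend a column of colours to a colouring. -/
def extend (x : List Bool) (f : ℕ × ℕ → Bool) : ℕ × ℕ → Bool
  | (0, p) => x.getD p false
  | (t + 1, p) => f (t, p)

theorem extend_eq_sides {x z : List Bool} {f : ℕ × ℕ → Bool} (h : ∀ p, f (0, p) = z.getD p false)
    {u : ℕ × ℕ} (hu : u.1 ≤ 1) : extend x f u = sides x z u := by
  obtain ⟨t, p⟩ := u
  match t, hu with
  | 0, _ => rfl
  | 1, _ => exact h p

theorem isColouring_extend {m : ℕ} {s : Slice} {w : List Slice} {x y z : List Bool}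
    {f : ℕ × ℕ → Bool} (hs : s.source = m) (hx : x.length = m) (hz : z ∈ s.act x)
    (hf : IsColouring s.target w z y f) : IsColouring m (s :: w) x y (extend x f) where
  arc u v huv := by
    rcases arc_cons.1 huv with h | ⟨u', v', h, rfl, rfl⟩
    · have h' := Slice.arc_zero_fst h
      rw [extend_eq_sides hf.left h'.1, extend_eq_sides hf.left h'.2]
      have hx' := hx.trans hs.symm
      exact (Slice.mem_act_iff hx' (Slice.length_of_mem_act hx' hz)).1 hz u v h
    · exact hf.arc _ _ h
  supp t p h := by
    cases t with
    | zero => exact List.getD_eq_default _ _ (hx.trans_le h)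
    | succ t => exact hf.supp t p h
  left p := rfl
  right p := hf.right p

theorem exists_eq_extend {m : ℕ} {s : Slice} {w : List Slice} {x y : List Bool}
    {f : ℕ × ℕ → Bool} (hs : s.source = m) (hx : x.length = m)
    (hf : IsColouring m (s :: w) x y f) :
    ∃ z ∈ s.act x, ∃ f', IsColouring s.target w z y f' ∧ f = extend x f' := by
  set f' : ℕ × ℕ → Bool := fun u => f (u.1 + 1, u.2) with hf'
  set z : List Bool := (List.range s.target).map fun p => f (1, p) with hz
  have hzl : z.length = s.target := by simp [hz]
  have hfz : ∀ p, f' (0, p) = z.getD p false := by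
    intro p
    by_cases hp : p < s.target
    · simp [hz, hp, hf']
    · rw [List.getD_eq_default _ _ (by omega)]
      refine hf.supp 1 p ?_
      cases w <;> simpa [level] using hp
  have hext : f = extend x f' := by
    funext ⟨t, p⟩
    cases t with
    | zero => exact hf.left p
    | succ t => rfl
  refine ⟨z, ?_, f', ⟨fun u v h => ?_, fun t p h => ?_, hfz, fun p => hf.right p⟩, hext⟩
  · refine (Slice.mem_act_iff (hx.trans hs.symm) hzl).2 fun u v h => ?_
    have h' := Slice.arc_zero_fst h
    rw [← extend_eq_sides hfz h'.1, ← extend_eq_sides hfz h'.2, ← hext]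
    exact hf.arc u v (arc_cons.2 (.inl h))
  · exact hf.arc _ _ (arc_cons.2 (.inr ⟨u, v, h, rfl, rfl⟩))
  · exact hf.supp (t + 1) p h

theorem eq_of_getD_eq {a b : List Bool} (h : a.length = b.length)
    (h' : ∀ p, a.getD p false = b.getD p false) : a = b := by
  refine List.ext_getElem h fun p h1 h2 => ?_
  simpa [h1, h2] using h' p

/-- The transfer multisets count colourings. -/
theorem card_isColouring {m n : ℕ} {w : List Slice} (hw : IsWord m n w) {x y : List Bool}
    (hx : x.length = m) (hy : y.length = n) :
    Finite {f // IsColouring m w x y f} ∧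
      Nat.card {f // IsColouring m w x y f} = (transfer w x).count y := by
  induction w generalizing m x with
  | nil =>
    obtain rfl : m = n := hw
    have hsub : Subsingleton {f // IsColouring m [] x y f} := by
      refine ⟨fun f g => Subtype.ext (funext fun ⟨t, p⟩ => ?_)⟩
      cases t with
      | zero => rw [f.2.left, g.2.left]
      | succ t => rw [f.2.supp _ _ (Nat.zero_le _), g.2.supp _ _ (Nat.zero_le _)]
    refine ⟨inferInstance, ?_⟩
    rw [transfer, Multiset.count_singleton]
    split_ifs with h
    · subst h
      have : Nonempty {f // IsColouring m [] y y f} := by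
        refine ⟨extend y fun _ => false, ?_, ?_, ?_, ?_⟩
        · rintro u v ⟨t, ht, _⟩; simp at ht
        · rintro (_ | t) p h
          · exact List.getD_eq_default _ _ (hx.trans_le h)
          · rfl
        · intro p; rfl
        · intro p; rfl
      exact Nat.card_unique
    · have : IsEmpty {f // IsColouring m [] x y f} :=
        ⟨fun f => h (eq_of_getD_eq (hy.trans hx.symm) fun p =>
          (f.2.right p).symm.trans (f.2.left p))⟩
      exact Nat.card_of_isEmpty
  | cons s w ih =>
    obtain ⟨hs, hw⟩ := hw
    set A : Finset (List Bool) := ⟨s.act x, s.nodup_act x⟩ with hA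
    have hl : ∀ z : A, z.1.length = s.target := fun z =>
      Slice.length_of_mem_act (hx.trans hs.symm) z.2
    have hfin : ∀ z : A, Finite {f // IsColouring s.target w z y f} := fun z => (ih hw (hl z)).1
    let φ : (Σ z : A, {f // IsColouring s.target w z y f}) →
        {f // IsColouring m (s :: w) x y f} :=
      fun q => ⟨extend x q.2.1, isColouring_extend hs hx q.1.2 q.2.2⟩
    have hφ : Function.Bijective φ := by
      constructor
      · rintro ⟨z, f, hf⟩ ⟨z', f', hf'⟩ h
        have h : extend x f = extend x f' := congrArg Subtype.val h
        have hff : f = f' := funext fun ⟨t, p⟩ => congrFun h (t + 1, p)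
        subst hff
        have hzz : z = z' := Subtype.ext (eq_of_getD_eq ((hl z).trans (hl z').symm)
          fun p => (hf.left p).symm.trans (hf'.left p))
        subst hzz
        rfl
      · rintro ⟨f, hf⟩
        obtain ⟨z, hz, f', hf', rfl⟩ := exists_eq_extend hs hx hf
        exact ⟨⟨⟨z, hz⟩, f', hf'⟩, rfl⟩
    refine ⟨Finite.of_surjective φ hφ.2, ?_⟩
    rw [← Nat.card_congr (Equiv.ofBijective φ hφ), Nat.card_sigma, transfer, Multiset.count_bind]
    rw [Finset.sum_congr rfl fun z _ => (ih hw (hl z)).2]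
    exact Finset.sum_coe_sort A fun z => (transfer w z).count y

/-! ### The transfer multisets determine the connection and the number of closed curves -/

theorem level_zero (m : ℕ) (w : List Slice) : level m w 0 = m := by cases w <;> rfl

theorem level_length {m n : ℕ} {w : List Slice} (hw : IsWord m n w) :
    level m w w.length = n := by
  induction w generalizing m with
  | nil => exact hw
  | cons s w ih => exact ih hw.2

theorem Slice.arc_lt_level {s : Slice} {w : List Slice} {u v : ℕ × ℕ} (h : s.Arc 0 u v) :
    u.2 < level s.source (s :: w) u.1 ∧ v.2 < level s.source (s :: w) v.1 := by
  have h0 : level s.source (s :: w) 0 = s.source := rfl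
  have h1 : level s.source (s :: w) 1 = s.target := level_zero _ w
  cases h <;> simp_all [Slice.source, Slice.target, Piece.ins, Piece.outs] <;> omega

theorem arc_lt_level {m n : ℕ} {w : List Slice} (hw : IsWord m n w) {u v : ℕ × ℕ}
    (h : Arc w u v) : u.2 < level m w u.1 ∧ v.2 < level m w v.1 := by
  induction w generalizing m u v with
  | nil => obtain ⟨t, ht, _⟩ := h; simp at ht
  | cons s w ih =>
    obtain ⟨rfl, hw⟩ := hw
    rcases arc_cons.1 h with h' | ⟨u', v', h', rfl, rfl⟩
    · exact Slice.arc_lt_level h'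
    · exact ih hw h'

theorem endPoint_lt_level {m n : ℕ} {w : List Slice} (hw : IsWord m n w) (e : Fin m ⊕ Fin n) :
    (endPoint m n w e).2 < level m w (endPoint m n w e).1 := by
  rcases e with p | q
  · simp [endPoint, level_zero]
  · simp [endPoint, level_length hw]

theorem Slice.exists_arc_right {s : Slice} {p : ℕ} (h : p < s.target) :
    ∃ v, s.Arc 0 v (1, p) ∨ s.Arc 0 (1, p) v := by
  obtain ⟨i, g, j⟩ := s
  rcases lt_or_ge p i with h1 | h1
  · exact ⟨_, .inl (.below p h1)⟩
  obtain ⟨p, rfl⟩ := Nat.exists_eq_add_of_le h1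
  rcases lt_or_ge p g.outs with h2 | h2
  · cases g with
    | crossing c =>
      obtain rfl | rfl : p = 0 ∨ p = 1 := by simp only [Piece.outs] at h2; omega
      · exact ⟨_, .inl (.down c rfl)⟩
      · exact ⟨_, .inl (.up c rfl)⟩
    | cap => simp [Piece.outs] at h2
    | cup =>
      obtain rfl | rfl : p = 0 ∨ p = 1 := by simp only [Piece.outs] at h2; omega
      · exact ⟨_, .inr (.cup rfl)⟩
      · exact ⟨_, .inl (.cup rfl)⟩
  · obtain ⟨p, rfl⟩ := Nat.exists_eq_add_of_le h2
    rw [← add_assoc]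
    exact ⟨_, .inl (.above p (by simp only [Slice.target] at h; simp only; omega))⟩

/-- Every point of a diagram that is not an end lies on an arc. -/
theorem exists_arc_or_end {m n : ℕ} {w : List Slice} (hw : IsWord m n w) {t p : ℕ}
    (h : p < level m w t) :
    (∃ v, Arc w v (t, p) ∨ Arc w (t, p) v) ∨ ∃ e, endPoint m n w e = (t, p) := by
  induction w generalizing m t with
  | nil =>
    cases t with
    | zero => exact .inr ⟨.inl ⟨p, h⟩, rfl⟩
    | succ t => simp [level] at h
  | cons s w ih =>
    obtain ⟨hs, hw⟩ := hw
    cases t with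
    | zero => exact .inr ⟨.inl ⟨p, h⟩, rfl⟩
    | succ t =>
      rcases ih hw h with ⟨v, hv | hv⟩ | ⟨e | e, he⟩
      · exact .inl ⟨_, .inl (arc_cons.2 (.inr ⟨_, _, hv, rfl, rfl⟩))⟩
      · exact .inl ⟨_, .inr (arc_cons.2 (.inr ⟨_, _, hv, rfl, rfl⟩))⟩
      · obtain ⟨rfl, rfl⟩ := Prod.mk.inj he
        obtain ⟨v, hv⟩ := Slice.exists_arc_right e.2
        exact .inl ⟨v, hv.imp (fun h => arc_cons.2 (.inl h)) fun h => arc_cons.2 (.inl h)⟩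
      · obtain ⟨rfl, rfl⟩ := Prod.mk.inj he
        exact .inr ⟨.inr e, rfl⟩

/-- The closed curves, as a subtype of the set of all curves. -/
abbrev ClosedCurve (m n : ℕ) (w : List Slice) : Type :=
  {c : Quotient (sameCurve w) //
    (∃ x y, Arc w x y ∧ Quotient.mk (sameCurve w) x = c) ∧
      ∀ e, Quotient.mk (sameCurve w) (endPoint m n w e) ≠ c}

theorem eq_of_sameCurve {w : List Slice} {f : ℕ × ℕ → Bool} (hf : ∀ u v, Arc w u v → f u = f v)
    {u v : ℕ × ℕ} (h : sameCurve w u v) : f u = f v := by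
  induction h with
  | rel u v h => exact hf u v h
  | refl u => rfl
  | symm u v _ ih => exact ih.symm
  | trans u v z _ _ ih ih' => exact ih.trans ih'

/-- A curve through a point of the diagram has an end or is closed. -/
theorem exists_end_or_closed {m n : ℕ} {w : List Slice} (hw : IsWord m n w) {u : ℕ × ℕ}
    (h : u.2 < level m w u.1) :
    (∃ e, Quotient.mk (sameCurve w) (endPoint m n w e) = Quotient.mk _ u) ∨
      ((∃ x y, Arc w x y ∧ Quotient.mk (sameCurve w) x = Quotient.mk _ u) ∧
        ∀ e, Quotient.mk (sameCurve w) (endPoint m n w e) ≠ Quotient.mk _ u) := by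
  by_cases he : ∃ e, Quotient.mk (sameCurve w) (endPoint m n w e) = Quotient.mk _ u
  · exact .inl he
  · refine .inr ⟨?_, not_exists.1 he⟩
    rcases exists_arc_or_end hw h with ⟨v, hv | hv⟩ | ⟨e, h⟩
    · exact ⟨v, _, hv, Quotient.sound (.rel _ _ hv)⟩
    · exact ⟨_, _, hv, rfl⟩
    · exact absurd ⟨e, congrArg _ h⟩ he

/-- The colours of the left ends, as a list. -/
def leftColours {m n : ℕ} (ε : Fin m ⊕ Fin n → Bool) : List Bool := List.ofFn fun p => ε (.inl p)

/-- The colours of the right ends, as a list. -/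
def rightColours {m n : ℕ} (ε : Fin m ⊕ Fin n → Bool) : List Bool := List.ofFn fun q => ε (.inr q)

theorem length_leftColours {m n : ℕ} (ε : Fin m ⊕ Fin n → Bool) :
    (leftColours ε).length = m := by simp [leftColours]

theorem length_rightColours {m n : ℕ} (ε : Fin m ⊕ Fin n → Bool) :
    (rightColours ε).length = n := by simp [rightColours]

theorem IsColouring.endPoint_eq {m n : ℕ} {w : List Slice} {ε : Fin m ⊕ Fin n → Bool}
    {f : ℕ × ℕ → Bool} (hf : IsColouring m w (leftColours ε) (rightColours ε) f)
    (e : Fin m ⊕ Fin n) : f (endPoint m n w e) = ε e := by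
  rcases e with p | q
  · simp [endPoint, hf.left, leftColours]
  · simp [endPoint, hf.right, rightColours]

theorem isColouring_of_endPoint_eq {m n : ℕ} {w : List Slice} (hw : IsWord m n w)
    {ε : Fin m ⊕ Fin n → Bool} {f : ℕ × ℕ → Bool} (arc : ∀ u v, Arc w u v → f u = f v)
    (supp : ∀ t p, level m w t ≤ p → f (t, p) = false)
    (hf : ∀ e, f (endPoint m n w e) = ε e) :
    IsColouring m w (leftColours ε) (rightColours ε) f where
  arc := arc
  supp := supp
  left p := by
    by_cases hp : p < m
    · simpa [leftColours, hp, endPoint] using hf (.inl ⟨p, hp⟩)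
    · rw [supp _ _ (by rw [level_zero]; omega),
        List.getD_eq_default _ _ (by simp [leftColours]; omega)]
  right p := by
    by_cases hp : p < n
    · simpa [rightColours, hp, endPoint] using hf (.inr ⟨p, hp⟩)
    · rw [supp _ _ (by rw [level_length hw]; omega),
        List.getD_eq_default _ _ (by simp [rightColours]; omega)]

open Classical in
/-- If the colours of the ends agree along the curves, then a colouring of the diagram amounts to
a choice of a colour for every closed curve. -/
theorem colouring_equiv_closedCurve {m n : ℕ} {w : List Slice} (hw : IsWord m n w)
    {ε : Fin m ⊕ Fin n → Bool} (hε : ∀ e e', connection m n w e e' → ε e = ε e') :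
    Nonempty ({f // IsColouring m w (leftColours ε) (rightColours ε) f} ≃
      (ClosedCurve m n w → Bool)) := by
  let φ : {f // IsColouring m w (leftColours ε) (rightColours ε) f} → ClosedCurve m n w → Bool :=
    fun f c => Quotient.lift f.1 (fun _ _ h => eq_of_sameCurve f.2.arc h) c.1
  refine ⟨Equiv.ofBijective φ ⟨?_, ?_⟩⟩
  · rintro ⟨f, hf⟩ ⟨f', hf'⟩ h
    refine Subtype.ext (funext fun u => ?_)
    show f u = f' u
    by_cases hu : u.2 < level m w u.1
    · rcases exists_end_or_closed hw hu with ⟨e, he⟩ | hc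
      · have he := Quotient.exact he
        rw [← eq_of_sameCurve hf.arc he, ← eq_of_sameCurve hf'.arc he, hf.endPoint_eq,
          hf'.endPoint_eq]
      · exact congrFun h ⟨_, hc⟩
    · rw [hf.supp u.1 u.2 (not_lt.1 hu), hf'.supp u.1 u.2 (not_lt.1 hu)]
  · intro g
    let F : Quotient (sameCurve w) → Bool := fun c =>
      if he : ∃ e, Quotient.mk (sameCurve w) (endPoint m n w e) = c then ε he.choose
      else if hc : ∃ x y, Arc w x y ∧ Quotient.mk (sameCurve w) x = c then
        g ⟨c, hc, not_exists.1 he⟩ else false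
    have hF : ∀ e, F (Quotient.mk _ (endPoint m n w e)) = ε e := by
      intro e
      have he : ∃ e', Quotient.mk (sameCurve w) (endPoint m n w e') =
        Quotient.mk _ (endPoint m n w e) := ⟨e, rfl⟩
      simp only [F, dif_pos he]
      have h : sameCurve w (endPoint m n w he.choose) (endPoint m n w e) :=
        Quotient.exact he.choose_spec
      exact hε _ _ h
    refine ⟨⟨fun u => if u.2 < level m w u.1 then F (Quotient.mk _ u) else false,
      isColouring_of_endPoint_eq hw (fun u v h => ?_) (fun t p h => ?_) fun e => ?_⟩, ?_⟩
    · have h' := arc_lt_level hw h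
      rw [if_pos h'.1, if_pos h'.2]
      exact congrArg F (Quotient.sound (.rel _ _ h))
    · rw [if_neg (not_lt.2 h)]
    · rw [if_pos (endPoint_lt_level hw e), hF]
    · funext c
      obtain ⟨_, ⟨x, y, hxy, rfl⟩, he⟩ := c
      show (if x.2 < level m w x.1 then F (Quotient.mk _ x) else false) = _
      rw [if_pos (arc_lt_level hw hxy).1]
      simp only [F]
      rw [dif_neg (not_exists.2 he), dif_pos ⟨x, y, hxy, rfl⟩]

theorem finite_closedCurve {m n : ℕ} {w : List Slice} (hw : IsWord m n w) :
    Finite (ClosedCurve m n w) := by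
  classical
  obtain ⟨φ⟩ := colouring_equiv_closedCurve hw (ε := fun _ => false) fun _ _ _ => rfl
  have := (card_isColouring hw (length_leftColours fun _ : Fin m ⊕ Fin n => false)
    (length_rightColours fun _ : Fin m ⊕ Fin n => false)).1
  have : Finite (ClosedCurve m n w → Bool) := Finite.of_equiv _ φ
  refine Finite.of_injective (fun c : ClosedCurve m n w => fun d => decide (c = d))
    fun c d h => ?_
  simpa using congrFun h d

theorem count_transfer_of_connection {m n : ℕ} {w : List Slice} (hw : IsWord m n w)
    {ε : Fin m ⊕ Fin n → Bool} (hε : ∀ e e', connection m n w e e' → ε e = ε e') :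
    (transfer w (leftColours ε)).count (rightColours ε) = 2 ^ loops m n w := by
  obtain ⟨φ⟩ := colouring_equiv_closedCurve hw hε
  have := finite_closedCurve hw
  rw [← (card_isColouring hw (length_leftColours ε) (length_rightColours ε)).2,
    Nat.card_congr φ, Nat.card_fun, Nat.card_eq_fintype_card, Fintype.card_bool]
  rfl

theorem connection_of_count_transfer_ne_zero {m n : ℕ} {w : List Slice} (hw : IsWord m n w)
    {ε : Fin m ⊕ Fin n → Bool}
    (h : (transfer w (leftColours ε)).count (rightColours ε) ≠ 0) {e e' : Fin m ⊕ Fin n}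
    (he : connection m n w e e') : ε e = ε e' := by
  rw [← (card_isColouring hw (length_leftColours ε) (length_rightColours ε)).2] at h
  obtain ⟨f, hf⟩ := (Nat.card_ne_zero.1 h).1
  rw [← hf.endPoint_eq, ← hf.endPoint_eq]
  exact eq_of_sameCurve hf.arc he

open Classical in
theorem connection_iff {m n : ℕ} {w : List Slice} (hw : IsWord m n w) (e e' : Fin m ⊕ Fin n) :
    connection m n w e e' ↔ ∀ ε : Fin m ⊕ Fin n → Bool,
      (transfer w (leftColours ε)).count (rightColours ε) ≠ 0 → ε e = ε e' := by
  refine ⟨fun he ε h => connection_of_count_transfer_ne_zero hw h he, fun H => ?_⟩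
  have := H (fun d => decide (connection m n w d e')) ?_
  · simpa [Setoid.refl'] using this
  · rw [count_transfer_of_connection hw]
    · positivity
    · intro d d' h
      have : connection m n w d e' ↔ connection m n w d' e' :=
        ⟨fun h' => Setoid.trans' _ (Setoid.symm' _ h) h', fun h' => Setoid.trans' _ h h'⟩
      simp [this]

/-- Two words whose transfer multisets agree up to a factor `2 ^ k` join the ends in the same way,
and the first has `k` more closed curves. -/
theorem connection_eq_and_loops_eq {m n k : ℕ} {w w' : List Slice} (hw : IsWord m n w)
    (hw' : IsWord m n w')
    (h : ∀ x : List Bool, x.length = m → transfer w x = 2 ^ k • transfer w' x) :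
    connection m n w = connection m n w' ∧ loops m n w = loops m n w' + k := by
  have hc : ∀ ε : Fin m ⊕ Fin n → Bool, (transfer w (leftColours ε)).count (rightColours ε) =
      2 ^ k * (transfer w' (leftColours ε)).count (rightColours ε) := fun ε => by
    rw [h _ (length_leftColours ε), Multiset.count_nsmul]
  constructor
  · ext e e'
    rw [connection_iff hw, connection_iff hw']
    simp [hc]
  · have := hc fun _ => false
    rw [count_transfer_of_connection hw fun _ _ _ => rfl,
      count_transfer_of_connection hw' fun _ _ _ => rfl, ← pow_add] at this
    rw [Nat.pow_right_injective le_rfl this, add_comm]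

/-! ### Transfer along composite, padded and flipped words -/

theorem isWord_append {m n : ℕ} {u v : List Slice} :
    IsWord m n (u ++ v) ↔ ∃ k, IsWord m k u ∧ IsWord k n v := by
  induction u generalizing m with
  | nil => simp [IsWord]
  | cons s u ih => simp [IsWord, ih, and_assoc]

theorem isWord_pad {a b : ℕ} {w : List Slice} (hw : IsWord a b w) (i j : ℕ) :
    IsWord (i + a + j) (i + b + j) (pad i j w) := by
  induction w generalizing a with
  | nil => rw [show a = b from hw]; rfl
  | cons s w ih =>
    obtain ⟨rfl, hw⟩ := hw
    refine ⟨?_, ?_⟩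
    · simp only [Slice.source]; omega
    · convert ih hw using 1
      · simp only [Slice.target]; omega
      · rfl

theorem isWord_flip {a b : ℕ} {w : List Slice} (hw : IsWord a b w) : IsWord a b (flip w) := by
  induction w generalizing a with
  | nil => exact hw
  | cons s w ih =>
    obtain ⟨rfl, hw⟩ := hw
    refine ⟨?_, ?_⟩
    · simp only [Slice.source]; omega
    · convert ih hw using 1
      · simp only [Slice.target]; omega
      · rfl

theorem IsWord.unique_right {m n n' : ℕ} {w : List Slice} (h : IsWord m n w)
    (h' : IsWord m n' w) : n = n' := by
  induction w generalizing m with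
  | nil => exact h.symm.trans h'
  | cons s w ih => exact ih h.2 h'.2

theorem IsWord.unique_left {m m' n n' : ℕ} {w : List Slice} (hne : w ≠ []) (h : IsWord m n w)
    (h' : IsWord m' n' w) : m = m' := by
  cases w with
  | nil => exact absurd rfl hne
  | cons s w => exact h.1.symm.trans h'.1

theorem transfer_append (u v : List Slice) (x : List Bool) :
    transfer (u ++ v) x = (transfer u x).bind (transfer v) := by
  induction u generalizing x with
  | nil => simp [transfer]
  | cons s u ih => simp [transfer, Multiset.bind_assoc, ih]

theorem transfer_pad {a b : ℕ} {w : List Slice} (hw : IsWord a b w) {x y z : List Bool} {i : ℕ}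
    (j : ℕ) (hx : x.length = i) (hy : y.length = a) :
    transfer (pad i j w) (x ++ y ++ z) = (transfer w y).map fun t => x ++ t ++ z := by
  induction w generalizing a y with
  | nil => simp [transfer, pad]
  | cons s w ih =>
    obtain ⟨rfl, hw⟩ := hw
    have hact : Slice.act ⟨i + s.below, s.piece, s.above + j⟩ (x ++ y ++ z) =
        (s.act y).map fun t => x ++ t ++ z := by
      obtain ⟨p, q, r, rfl, hp, hq, hr⟩ := exists_append_of_length hy
      rw [s.act_append r hp hq, show x ++ (p ++ q ++ r) ++ z = (x ++ p) ++ q ++ (r ++ z) by simp,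
        Slice.act_append ⟨i + s.below, s.piece, s.above + j⟩ _ (by simp [hx, hp]) hq,
        Multiset.map_map]
      simp
    change (Slice.act ⟨i + s.below, s.piece, s.above + j⟩ (x ++ y ++ z)).bind
      (transfer (pad i j w)) = _
    rw [hact, Multiset.bind_map, transfer, Multiset.map_bind]
    exact Multiset.bind_congr fun t ht => ih hw (Slice.length_of_mem_act hy ht)

theorem Piece.act_reverse (g : Piece) {x : List Bool} (hx : x.length = g.ins) :
    g.act x.reverse = (g.act x).map List.reverse := by
  cases g with
  | crossing c =>
    obtain ⟨p, q, rfl⟩ := List.length_eq_two.1 hx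
    simp [Piece.act]
  | cap =>
    obtain ⟨p, q, rfl⟩ := List.length_eq_two.1 hx
    revert p q
    decide
  | cup =>
    obtain rfl := List.length_eq_zero_iff.1 hx
    simp [Piece.act]

theorem transfer_flip {a b : ℕ} {w : List Slice} (hw : IsWord a b w) {x : List Bool}
    (hx : x.length = a) :
    transfer (flip w) x.reverse = (transfer w x).map List.reverse := by
  induction w generalizing a x with
  | nil => simp [transfer, flip]
  | cons s w ih =>
    obtain ⟨rfl, hw⟩ := hw
    have hact : Slice.act ⟨s.above, s.piece, s.below⟩ x.reverse =
        (s.act x).map List.reverse := by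
      obtain ⟨p, q, r, rfl, hp, hq, hr⟩ := exists_append_of_length hx
      rw [s.act_append r hp hq, List.reverse_append, List.reverse_append, ← List.append_assoc,
        Slice.act_append _ _ (by simp [hr]) (by simp [hq]), Multiset.map_map, Piece.act_reverse _ hq,
        Multiset.map_map]
      simp
    change (Slice.act ⟨s.above, s.piece, s.below⟩ x.reverse).bind (transfer (flip w)) = _
    rw [hact, Multiset.bind_map, transfer, Multiset.map_bind]
    exact Multiset.bind_congr fun t ht => ih hw (Slice.length_of_mem_act hx ht)

theorem Piece.act_map_not (g : Piece) (x : List Bool) :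
    g.act (x.map not) = (g.act x).map (List.map not) := by
  unfold Piece.act
  rcases g with c | _ | _ <;> rcases x with _ | ⟨p, _ | ⟨q, _ | ⟨r, x⟩⟩⟩
  all_goals simp
  · revert p q
    decide
  · exact Multiset.cons_swap _ _ 0

/-- Exchanging the two colours is a symmetry. -/
theorem transfer_map_not (w : List Slice) (x : List Bool) :
    transfer w (x.map not) = (transfer w x).map (List.map not) := by
  induction w generalizing x with
  | nil => simp [transfer]
  | cons s w ih =>
    have hact : s.act (x.map not) = (s.act x).map (List.map not) := by
      simp only [Slice.act, ← List.map_take, ← List.map_drop, Piece.act_map_not,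
        Multiset.map_map]
      simp
    rw [transfer, hact, Multiset.bind_map, transfer, Multiset.map_bind]
    exact Multiset.bind_congr fun t _ => ih t

/-- The parity of the number of ends with colour `true` is the same on both sides. -/
theorem parity_of_mem_transfer {a b : ℕ} {w : List Slice} (hw : IsWord a b w) {x z : List Bool}
    (hx : x.length = a) (hz : z ∈ transfer w x) :
    z.count true % 2 = x.count true % 2 := by
  induction w generalizing a x with
  | nil => simp only [transfer, Multiset.mem_singleton] at hz; rw [hz]
  | cons s w ih =>
    obtain ⟨rfl, hw⟩ := hw
    rw [transfer, Multiset.mem_bind] at hz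
    obtain ⟨y, hy, hz⟩ := hz
    rw [ih hw (Slice.length_of_mem_act hx hy) hz]
    obtain ⟨p, q, r, rfl, hp, hq, hr⟩ := exists_append_of_length hx
    rw [s.act_append r hp hq, Multiset.mem_map] at hy
    obtain ⟨t, ht, rfl⟩ := hy
    have : t.count true % 2 = q.count true % 2 := by
      unfold Piece.act at ht
      split at ht
      · simp only [Multiset.mem_singleton] at ht
        subst ht
        simp only [List.count_cons, List.count_nil]; omega
      · split_ifs at ht with h
        · simp only [Multiset.mem_singleton] at ht
          subst ht h
          simp only [List.count_cons, List.count_nil]; omega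
        · simp at ht
      · simp at ht; rcases ht with rfl | rfl <;> rfl
      · simp at ht
    simp only [List.count_append]
    omega

/-- The two turns `⊃⊂`. -/
def turns : List Slice := [⟨0, .cap, 0⟩, ⟨0, .cup, 0⟩]

theorem cases_of_length_two {x : List Bool} (hx : x.length = 2) :
    (x.count true % 2 = 0 ∧ x.reverse = x ∧ transfer turns x = {x} + {x.map not}) ∨
      (x.count true % 2 = 1 ∧ x.reverse = x.map not ∧ transfer turns x = 0) := by
  obtain ⟨p, q, rfl⟩ := List.length_eq_two.1 hx
  revert p q
  decide

/-- With two colours, a four-ended tangle cannot be told from the same tangle upside down: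
reversing two equal colours does nothing, and reversing two different colours amounts to exchanging
the colours. -/
theorem transfer_flip_eq {p : List Slice} (hp : IsWord 2 2 p) {x : List Bool}
    (hx : x.length = 2) : transfer (flip p) x = transfer p x := by
  have h := transfer_flip hp (x := x.reverse) (by simp [hx])
  rw [List.reverse_reverse] at h
  rw [h]
  rcases cases_of_length_two hx with ⟨h1, h2, -⟩ | ⟨h1, h2, -⟩
  · rw [h2]
    refine (Multiset.map_congr rfl fun z hz => ?_).trans (Multiset.map_id _)
    have hz' := parity_of_mem_transfer hp hx hz
    rcases cases_of_length_two (length_of_mem_transfer hp hx hz) with ⟨h3, h4, -⟩ | ⟨h3, h4, -⟩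
    · exact h4
    · omega
  · rw [h2, transfer_map_not, Multiset.map_map]
    refine (Multiset.map_congr rfl fun z hz => ?_).trans (Multiset.map_id _)
    have hz' := parity_of_mem_transfer hp hx hz
    rcases cases_of_length_two (length_of_mem_transfer hp hx hz) with ⟨h3, h4, -⟩ | ⟨h3, h4, -⟩
    · omega
    · simp [← List.map_reverse, h4, Function.comp_def]

/-- A four-ended tangle commutes with `⊃⊂` as far as two colours can tell. -/
theorem transfer_turns_comm {p : List Slice} (hp : IsWord 2 2 p) {x : List Bool}
    (hx : x.length = 2) : transfer (turns ++ p) x = transfer (p ++ turns) x := by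
  rw [transfer_append, transfer_append]
  rcases cases_of_length_two hx with ⟨h1, -, h2⟩ | ⟨h1, -, h2⟩
  · have : (transfer p x).bind (transfer turns) =
        (transfer p x).bind fun z => {z} + {z.map not} := by
      refine Multiset.bind_congr fun z hz => ?_
      have hz' := parity_of_mem_transfer hp hx hz
      rcases cases_of_length_two (length_of_mem_transfer hp hx hz) with ⟨h3, -, h4⟩ | ⟨h3, -, -⟩
      · exact h4
      · omega
    rw [this, h2, Multiset.add_bind, Multiset.singleton_bind, Multiset.singleton_bind,
      Multiset.bind_add, Multiset.bind_singleton, Multiset.bind_singleton, Multiset.map_id',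
      transfer_map_not]
  · rw [h2, Multiset.zero_bind]
    refine (Multiset.bind_congr fun z hz => ?_).trans (Multiset.bind_zero _) |>.symm
    have hz' := parity_of_mem_transfer hp hx hz
    rcases cases_of_length_two (length_of_mem_transfer hp hx hz) with ⟨h3, -, -⟩ | ⟨h3, -, h4⟩
    · omega
    · exact h4

/-- Diagrams above one another can be exchanged from left to right. -/
theorem transfer_exchange {a b c d k : ℕ} {u v : List Slice} (hu : IsWord a b u)
    (hv : IsWord c d v) {x : List Bool} (hx : x.length = a + k + c) :
    transfer (pad 0 (k + c) u ++ pad (b + k) 0 v) x =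
      transfer (pad (a + k) 0 v ++ pad 0 (k + d) u) x := by
  obtain ⟨p, q, r, rfl, hp, hq, hr⟩ := exists_append_of_length hx
  have h1 : transfer (pad 0 (k + c) u) (p ++ q ++ r) = (transfer u p).map fun t => t ++ q ++ r := by
    simpa using transfer_pad hu (x := []) (z := q ++ r) (k + c) rfl hp
  have h2 : transfer (pad (a + k) 0 v) (p ++ q ++ r) = (transfer v r).map fun t => p ++ q ++ t := by
    simpa using transfer_pad hv (x := p ++ q) (z := []) 0 (by simp [hp, hq]) hr
  rw [transfer_append, transfer_append, h1, h2, Multiset.bind_map, Multiset.bind_map]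
  have h3 : ∀ t ∈ transfer u p, transfer (pad (b + k) 0 v) (t ++ q ++ r) =
      (transfer v r).bind fun s => {t ++ q ++ s} := by
    intro t ht
    rw [Multiset.bind_singleton]
    simpa using transfer_pad hv (x := t ++ q) (z := []) 0
      (by simp [hq, length_of_mem_transfer hu hp ht]) hr
  have h4 : ∀ s ∈ transfer v r, transfer (pad 0 (k + d) u) (p ++ q ++ s) =
      (transfer u p).bind fun t => {t ++ q ++ s} := by
    intro s hs
    rw [Multiset.bind_singleton]
    simpa using transfer_pad hu (x := []) (z := q ++ s) (k + d) rfl hp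
  rw [Multiset.bind_congr h3, Multiset.bind_congr h4, Multiset.bind_bind]

/-! ### Linear functionals on states -/

/-- The value of the linear extension of `β` at the combination of the states of `w`. -/
noncomputable def evalStates (β : List Slice → LaurentPolynomial ℤ) (w : List Slice) :
    LaurentPolynomial ℤ :=
  ((states w).map fun x => x.1 * β x.2).sum

theorem evalStates_nil (β : List Slice → LaurentPolynomial ℤ) : evalStates β [] = β [] := by
  simp [evalStates, states]

theorem evalStates_pos (β : List Slice → LaurentPolynomial ℤ) (i j : ℕ) (w : List Slice) :
    evalStates β (⟨i, .crossing .pos, j⟩ :: w) =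
      T 1 * evalStates (fun x => β (⟨i, .cap, j⟩ :: ⟨i, .cup, j⟩ :: x)) w +
        T (-1) * evalStates β w := by
  simp [evalStates, states, turned, Function.comp_def, mul_assoc, List.sum_map_mul_left,
    -LaurentPolynomial.T_mul]

theorem evalStates_neg (β : List Slice → LaurentPolynomial ℤ) (i j : ℕ) (w : List Slice) :
    evalStates β (⟨i, .crossing .neg, j⟩ :: w) =
      T 1 * evalStates β w +
        T (-1) * evalStates (fun x => β (⟨i, .cap, j⟩ :: ⟨i, .cup, j⟩ :: x)) w := by
  simp [evalStates, states, turned, Function.comp_def, mul_assoc, List.sum_map_mul_left,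
    -LaurentPolynomial.T_mul]

theorem evalStates_virt (β : List Slice → LaurentPolynomial ℤ) (i j : ℕ) (w : List Slice) :
    evalStates β (⟨i, .crossing .virt, j⟩ :: w) =
      evalStates (fun x => β (⟨i, .crossing .virt, j⟩ :: x)) w := by
  simp [evalStates, states, Function.comp_def]

theorem evalStates_cap (β : List Slice → LaurentPolynomial ℤ) (i j : ℕ) (w : List Slice) :
    evalStates β (⟨i, .cap, j⟩ :: w) = evalStates (fun x => β (⟨i, .cap, j⟩ :: x)) w := by
  simp [evalStates, states, Function.comp_def]

theorem evalStates_cup (β : List Slice → LaurentPolynomial ℤ) (i j : ℕ) (w : List Slice) :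
    evalStates β (⟨i, .cup, j⟩ :: w) = evalStates (fun x => β (⟨i, .cup, j⟩ :: x)) w := by
  simp [evalStates, states, Function.comp_def]

/-- Induction over words, one case for every kind of slice. -/
theorem word_induction {P : List Slice → Prop} (nil : P [])
    (pos : ∀ i j w, P w → P (⟨i, .crossing .pos, j⟩ :: w))
    (neg : ∀ i j w, P w → P (⟨i, .crossing .neg, j⟩ :: w))
    (virt : ∀ i j w, P w → P (⟨i, .crossing .virt, j⟩ :: w))
    (cap : ∀ i j w, P w → P (⟨i, .cap, j⟩ :: w))
    (cup : ∀ i j w, P w → P (⟨i, .cup, j⟩ :: w)) (w : List Slice) : P w := by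
  induction w with
  | nil => exact nil
  | cons s w ih =>
    obtain ⟨i, (_ | _ | _) | _ | _, j⟩ := s
    · exact pos i j w ih
    · exact neg i j w ih
    · exact virt i j w ih
    · exact cap i j w ih
    · exact cup i j w ih

theorem evalStates_append (β : List Slice → LaurentPolynomial ℤ) (u v : List Slice) :
    evalStates β (u ++ v) = evalStates (fun x => evalStates (fun y => β (x ++ y)) v) u := by
  induction u using word_induction generalizing β <;>
    simp_all [evalStates_nil, evalStates_pos, evalStates_neg, evalStates_virt, evalStates_cap,
      evalStates_cup]

theorem evalStates_pad (β : List Slice → LaurentPolynomial ℤ) (i j : ℕ) (w : List Slice) :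
    evalStates β (pad i j w) = evalStates (fun x => β (pad i j x)) w := by
  induction w using word_induction generalizing β <;>
    simp_all [evalStates_nil, evalStates_pos, evalStates_neg, evalStates_virt, evalStates_cap,
      evalStates_cup, pad]

theorem evalStates_flip (β : List Slice → LaurentPolynomial ℤ) (w : List Slice) :
    evalStates β (flip w) = evalStates (fun x => β (flip x)) w := by
  induction w using word_induction generalizing β <;>
    simp_all [evalStates_nil, evalStates_pos, evalStates_neg, evalStates_virt, evalStates_cap,
      evalStates_cup, flip]

theorem evalStates_add (β γ : List Slice → LaurentPolynomial ℤ) (w : List Slice) :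
    evalStates (fun x => β x + γ x) w = evalStates β w + evalStates γ w := by
  simp [evalStates, mul_add, List.sum_map_add]

theorem evalStates_mul_left (c : LaurentPolynomial ℤ) (β : List Slice → LaurentPolynomial ℤ)
    (w : List Slice) : evalStates (fun x => c * β x) w = c * evalStates β w := by
  simp only [evalStates, mul_left_comm _ c, List.sum_map_mul_left]

theorem evalStates_comm (β : List Slice → List Slice → LaurentPolynomial ℤ) (u v : List Slice) :
    evalStates (fun x => evalStates (fun y => β x y) v) u =
      evalStates (fun y => evalStates (fun x => β x y) u) v := by
  induction u using word_induction generalizing β <;>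
    simp_all [evalStates_nil, evalStates_pos, evalStates_neg, evalStates_virt, evalStates_cap,
      evalStates_cup, evalStates_add, evalStates_mul_left, -LaurentPolynomial.T_mul]

theorem evalStates_congr {m n : ℕ} {w : List Slice} (hw : IsWord m n w)
    {β γ : List Slice → LaurentPolynomial ℤ} (h : ∀ x, IsWord m n x → β x = γ x) :
    evalStates β w = evalStates γ w := by
  induction w using word_induction generalizing m β γ with
  | nil => simpa [evalStates_nil] using h _ hw
  | pos i j w ih =>
    obtain ⟨rfl, hw⟩ := hw
    rw [evalStates_pos, evalStates_pos, ih hw h,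
      ih hw fun x hx => h (⟨i, .cap, j⟩ :: ⟨i, .cup, j⟩ :: x) ⟨rfl, rfl, hx⟩]
  | neg i j w ih =>
    obtain ⟨rfl, hw⟩ := hw
    rw [evalStates_neg, evalStates_neg, ih hw h,
      ih hw fun x hx => h (⟨i, .cap, j⟩ :: ⟨i, .cup, j⟩ :: x) ⟨rfl, rfl, hx⟩]
  | virt i j w ih =>
    obtain ⟨rfl, hw⟩ := hw
    rw [evalStates_virt, evalStates_virt,
      ih hw fun x hx => h (⟨i, .crossing .virt, j⟩ :: x) ⟨rfl, hx⟩]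
  | cap i j w ih =>
    obtain ⟨rfl, hw⟩ := hw
    rw [evalStates_cap, evalStates_cap,
      ih hw fun x hx => h (⟨i, .cap, j⟩ :: x) ⟨rfl, hx⟩]
  | cup i j w ih =>
    obtain ⟨rfl, hw⟩ := hw
    rw [evalStates_cup, evalStates_cup,
      ih hw fun x hx => h (⟨i, .cup, j⟩ :: x) ⟨rfl, hx⟩]

/-! ### Local invariance -/

/-- `β` takes the same values on words from `a` to `b` ends that join these ends in the same way,
up to a factor `loopValue` for every closed curve.  The hypothesis is expressed by the transfer
multisets. -/
def IsLocal (a b : ℕ) (β : List Slice → LaurentPolynomial ℤ) : Prop :=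
  ∀ (k : ℕ) (x y : List Slice), IsWord a b x → IsWord a b y →
    (∀ c : List Bool, c.length = a → transfer x c = 2 ^ k • transfer y c) →
    β x = loopValue ^ k * β y

theorem IsLocal.eq_of_transfer_eq {a b : ℕ} {β : List Slice → LaurentPolynomial ℤ}
    (hβ : IsLocal a b β) {x y : List Slice} (hx : IsWord a b x) (hy : IsWord a b y)
    (h : ∀ c : List Bool, c.length = a → transfer x c = transfer y c) : β x = β y := by
  simpa using hβ 0 x y hx hy (by simpa using h)

theorem isLocal_evalStates {a b m n : ℕ} {f : List Slice → List Slice → LaurentPolynomial ℤ}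
    {w : List Slice} (hw : IsWord m n w) (h : ∀ y, IsWord m n y → IsLocal a b fun x => f x y) :
    IsLocal a b fun x => evalStates (f x) w := by
  intro k x y hx hy hxy
  rw [← evalStates_mul_left]
  exact evalStates_congr hw fun z hz => h z hz k x y hx hy hxy

theorem nsmul_bind {α : Type*} (k : ℕ) (s : Multiset α) (f : α → Multiset α) :
    (k • s).bind f = k • s.bind f := by
  induction k with
  | zero => simp
  | succ k ih => rw [succ_nsmul, succ_nsmul, Multiset.add_bind, ih]

theorem bind_nsmul {α : Type*} (k : ℕ) (s : Multiset α) (f : α → Multiset α) :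
    (s.bind fun x => k • f x) = k • s.bind f := by
  induction k with
  | zero => simp
  | succ k ih => simp only [succ_nsmul, Multiset.bind_add, ih]

/-- A local functional stays local when its argument is placed into a larger diagram. -/
theorem IsLocal.context {a b i j m n : ℕ} {β : List Slice → LaurentPolynomial ℤ}
    (hβ : IsLocal m n β) {u v : List Slice} (hu : IsWord m (i + a + j) u)
    (hv : IsWord (i + b + j) n v) : IsLocal a b fun x => β (u ++ pad i j x ++ v) := by
  intro k x y hx hy hxy
  have hword : ∀ {z}, IsWord a b z → IsWord m n (u ++ pad i j z ++ v) := fun hz =>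
    isWord_append.2 ⟨_, isWord_append.2 ⟨_, hu, isWord_pad hz i j⟩, hv⟩
  refine hβ k _ _ (hword hx) (hword hy) fun c hc => ?_
  rw [transfer_append, transfer_append, transfer_append, transfer_append, Multiset.bind_assoc,
    Multiset.bind_assoc, ← bind_nsmul]
  refine Multiset.bind_congr fun d hd => ?_
  obtain ⟨p, q, r, rfl, hp, hq, -⟩ := exists_append_of_length (length_of_mem_transfer hu hc hd)
  rw [transfer_pad hx j hp hq, transfer_pad hy j hp hq, hxy q hq, Multiset.map_nsmul,
    nsmul_bind]

/-- Two words from `a` to `b` ends are skein equivalent if no local functional distinguishes their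
combinations of states. -/
def SkeinEquiv (a b : ℕ) (l r : List Slice) : Prop :=
  IsWord a b l ∧ IsWord a b r ∧ ∀ β, IsLocal a b β → evalStates β l = evalStates β r

theorem SkeinEquiv.context {a b i j m n : ℕ} {l r u v : List Slice} (h : SkeinEquiv a b l r)
    (hu : IsWord m (i + a + j) u) (hv : IsWord (i + b + j) n v) :
    SkeinEquiv m n (u ++ pad i j l ++ v) (u ++ pad i j r ++ v) := by
  obtain ⟨hl, hr, h⟩ := h
  refine ⟨isWord_append.2 ⟨_, isWord_append.2 ⟨_, hu, isWord_pad hl i j⟩, hv⟩,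
    isWord_append.2 ⟨_, isWord_append.2 ⟨_, hu, isWord_pad hr i j⟩, hv⟩, fun β hβ => ?_⟩
  have key : ∀ w, evalStates β (u ++ pad i j w ++ v) = evalStates (fun x =>
      evalStates (fun y => evalStates (fun z => β (y ++ pad i j x ++ z)) v) u) w := by
    intro w
    simp only [evalStates_append, evalStates_pad]
    exact evalStates_comm (fun y x => evalStates (fun z => β (y ++ pad i j x ++ z)) v) u w
  rw [key, key]
  exact h _ (isLocal_evalStates hu fun y hy => isLocal_evalStates hv fun z hz =>
    hβ.context hy hz)

/-! ### Skein equivalence of the two sides of the planar, Reidemeister and virtual moves -/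

instance decidableIsWord : (m n : ℕ) → (w : List Slice) → Decidable (IsWord m n w)
  | m, n, [] => inferInstanceAs (Decidable (m = n))
  | m, n, s :: w =>
    have := decidableIsWord s.target n w
    inferInstanceAs (Decidable (s.source = m ∧ IsWord s.target n w))

/-- All lists of colours of a given length. -/
def colourings : ℕ → List (List Bool)
  | 0 => [[]]
  | n + 1 => (colourings n).flatMap fun c => [false :: c, true :: c]

theorem mem_colourings {n : ℕ} {c : List Bool} (h : c.length = n) : c ∈ colourings n := by
  induction c generalizing n with
  | nil => subst h; simp [colourings]
  | cons p c ih =>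
    subst h
    exact List.mem_flatMap.2 ⟨c, ih rfl, by cases p <;> simp⟩

/-- The relation between single states that local functionals respect, in decidable form: `x` and
`y` join the ends in the same way, and `x` has `k` more closed curves. -/
def Reduces (a b k : ℕ) (x y : List Slice) : Prop :=
  IsWord a b x ∧ IsWord a b y ∧ ∀ c ∈ colourings a, transfer x c = 2 ^ k • transfer y c

instance (a b k : ℕ) (x y : List Slice) : Decidable (Reduces a b k x y) :=
  inferInstanceAs (Decidable (_ ∧ _ ∧ _))

theorem IsLocal.eq_of_reduces {a b k : ℕ} {β : List Slice → LaurentPolynomial ℤ}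
    (hβ : IsLocal a b β) {x y : List Slice} (h : Reduces a b k x y) :
    β x = loopValue ^ k * β y :=
  hβ k x y h.1 h.2.1 fun c hc => h.2.2 c (mem_colourings hc)

theorem T_one_mul_T_neg_one : (T 1 * T (-1) : LaurentPolynomial ℤ) = 1 := by
  rw [← LaurentPolynomial.T_add]; exact LaurentPolynomial.T_zero

theorem loopValue_eq : loopValue = -(T 1) ^ 2 - (T (-1)) ^ 2 := by
  rw [loopValue, LaurentPolynomial.T_pow, LaurentPolynomial.T_pow]; norm_num

/-- After smoothing the crossing, the turn can be straightened on both sides; the `A`-smoothing of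
`c` on one side corresponds to that of `c.opp` on the other. -/
theorem skeinEquiv_slide_cap (c : Crossing) :
    SkeinEquiv 3 1 [cr 0 c 1, ⟨1, .cap, 0⟩] [cr 1 c.opp 0, ⟨0, .cap, 1⟩] := by
  refine ⟨by cases c <;> decide, by cases c <;> decide, fun β hβ => ?_⟩
  have h1 := hβ.eq_of_reduces (k := 0) (x := [⟨0, .cap, 1⟩, ⟨0, .cup, 1⟩, ⟨1, .cap, 0⟩])
    (y := [⟨0, .cap, 1⟩]) (by decide)
  have h2 := hβ.eq_of_reduces (k := 0) (x := [⟨1, .cap, 0⟩, ⟨1, .cup, 0⟩, ⟨0, .cap, 1⟩])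
    (y := [⟨1, .cap, 0⟩]) (by decide)
  have h3 := hβ.eq_of_reduces (k := 0) (x := [⟨0, .crossing .virt, 1⟩, ⟨1, .cap, 0⟩])
    (y := [⟨1, .crossing .virt, 0⟩, ⟨0, .cap, 1⟩]) (by decide)
  cases c <;> simp [cr, Crossing.opp, evalStates_nil, evalStates_pos, evalStates_neg,
    evalStates_virt, evalStates_cap, h1, h2, h3]

theorem skeinEquiv_slide_cup (c : Crossing) :
    SkeinEquiv 1 3 [⟨1, .cup, 0⟩, cr 0 c 1] [⟨0, .cup, 1⟩, cr 1 c.opp 0] := by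
  refine ⟨by cases c <;> decide, by cases c <;> decide, fun β hβ => ?_⟩
  have h1 := hβ.eq_of_reduces (k := 0) (x := [⟨1, .cup, 0⟩, ⟨0, .cap, 1⟩, ⟨0, .cup, 1⟩])
    (y := [⟨0, .cup, 1⟩]) (by decide)
  have h2 := hβ.eq_of_reduces (k := 0) (x := [⟨0, .cup, 1⟩, ⟨1, .cap, 0⟩, ⟨1, .cup, 0⟩])
    (y := [⟨1, .cup, 0⟩]) (by decide)
  have h3 := hβ.eq_of_reduces (k := 0) (x := [⟨1, .cup, 0⟩, ⟨0, .crossing .virt, 1⟩])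
    (y := [⟨0, .cup, 1⟩, ⟨1, .crossing .virt, 0⟩]) (by decide)
  cases c <;> simp [cr, Crossing.opp, evalStates_nil, evalStates_pos, evalStates_neg,
    evalStates_virt, evalStates_cup, h1, h2, h3]

theorem skeinEquiv_of_reduces {a b : ℕ} {l r : List Slice} (h : Reduces a b 0 l r)
    (hl : ∀ β, evalStates β l = β l) (hr : ∀ β, evalStates β r = β r) : SkeinEquiv a b l r :=
  ⟨h.1, h.2.1, fun β hβ => by simpa [hl, hr] using hβ.eq_of_reduces h⟩

/-- Every state of a slice is a state of its piece with strands below and above. -/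
theorem evalStates_singleton (β : List Slice → LaurentPolynomial ℤ) (s : Slice) :
    evalStates β [s] = evalStates (fun x => β (pad s.below s.above x)) [⟨0, s.piece, 0⟩] := by
  rw [← evalStates_pad]
  simp [pad]

theorem skeinEquiv_exchange (g h : Piece) (k : ℕ) :
    SkeinEquiv (g.ins + k + h.ins) (g.outs + k + h.outs)
      [⟨0, g, k + h.ins⟩, ⟨g.outs + k, h, 0⟩] [⟨g.ins + k, h, 0⟩, ⟨0, g, k + h.outs⟩] := by
  have hw : ∀ p : Piece, IsWord p.ins p.outs [⟨0, p, 0⟩] := by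
    intro p; simp [IsWord, Slice.source, Slice.target]
  refine ⟨?_, ?_, fun β hβ => ?_⟩
  · simp [IsWord, Slice.source, Slice.target]; omega
  · simp [IsWord, Slice.source, Slice.target]; omega
  have e1 := evalStates_append β [⟨0, g, k + h.ins⟩] [⟨g.outs + k, h, 0⟩]
  have e2 := evalStates_append β [⟨g.ins + k, h, 0⟩] [⟨0, g, k + h.outs⟩]
  rw [evalStates_singleton] at e1 e2
  simp only [evalStates_singleton _ ⟨g.outs + k, h, 0⟩] at e1
  simp only [evalStates_singleton _ ⟨0, g, k + h.outs⟩] at e2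
  rw [evalStates_comm fun x y => β (pad (g.ins + k) 0 x ++ pad 0 (k + h.outs) y)] at e2
  refine e1.trans (Eq.trans ?_ e2.symm)
  refine evalStates_congr (hw g) fun x hx => evalStates_congr (hw h) fun y hy => ?_
  refine hβ.eq_of_transfer_eq ?_ ?_ fun c hc => transfer_exchange hx hy hc
  · refine isWord_append.2 ⟨g.outs + k + h.ins, ?_, ?_⟩
    · simpa [add_assoc] using isWord_pad hx 0 (k + h.ins)
    · simpa using isWord_pad hy (g.outs + k) 0
  · refine isWord_append.2 ⟨g.ins + k + h.outs, ?_, ?_⟩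
    · simpa using isWord_pad hy (g.ins + k) 0
    · simpa [add_assoc] using isWord_pad hx 0 (k + h.outs)

theorem skeinEquiv_zigzag_up : SkeinEquiv 1 1 [⟨1, .cup, 0⟩, ⟨0, .cap, 1⟩] [] :=
  skeinEquiv_of_reduces (by decide) (by simp [evalStates_nil, evalStates_cap, evalStates_cup])
    (by simp [evalStates_nil])

theorem skeinEquiv_zigzag_down : SkeinEquiv 1 1 [⟨0, .cup, 1⟩, ⟨1, .cap, 0⟩] [] :=
  skeinEquiv_of_reduces (by decide) (by simp [evalStates_nil, evalStates_cap, evalStates_cup])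
    (by simp [evalStates_nil])

/-- Four smoothings: `A * A⁻¹ = 1` leaves the parallel strands, and the closed curve in the state
`⊃⊂⊃⊂` makes the coefficient of `⊃⊂` vanish, since `A ^ 2 + A ^ (-2) + loopValue = 0`. -/
theorem skeinEquiv_two (c : Crossing) : SkeinEquiv 2 2 [cr 0 c 0, cr 0 c.opp 0] [] := by
  refine ⟨by cases c <;> decide, by decide, fun β hβ => ?_⟩
  have h1 := hβ.eq_of_reduces (k := 1)
    (x := [⟨0, .cap, 0⟩, ⟨0, .cup, 0⟩, ⟨0, .cap, 0⟩, ⟨0, .cup, 0⟩])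
    (y := [⟨0, .cap, 0⟩, ⟨0, .cup, 0⟩]) (by decide)
  have h2 := hβ.eq_of_reduces (k := 0) (x := [⟨0, .crossing .virt, 0⟩, ⟨0, .crossing .virt, 0⟩])
    (y := []) (by decide)
  have hT := T_one_mul_T_neg_one
  have hd := loopValue_eq
  cases c <;> simp only [cr, Crossing.opp, evalStates_nil, evalStates_pos, evalStates_neg,
    evalStates_virt, h1, h2] <;> grind

/-- The states of both sides are combined to words in the two turns `⊃⊂` at heights `0` and `1`,
which are reduced by the Temperley-Lieb relations `h1` to `h4`; the rest is an identity of Laurent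
polynomials. -/
theorem skeinEquiv_three {a b c : Crossing} (ha : a ≠ .virt) (hb : b ≠ .virt) (hc : c ≠ .virt)
    (h : a = c → b = a) : SkeinEquiv 3 3 (triangle a b c) (triangle' a b c) := by
  refine ⟨by revert a b c; rintro (_ | _ | _) (_ | _ | _) (_ | _ | _) <;> decide,
    by revert a b c; rintro (_ | _ | _) (_ | _ | _) (_ | _ | _) <;> decide, fun β hβ => ?_⟩
  have h1 := hβ.eq_of_reduces (k := 1)
    (x := [⟨0, .cap, 1⟩, ⟨0, .cup, 1⟩, ⟨0, .cap, 1⟩, ⟨0, .cup, 1⟩])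
    (y := [⟨0, .cap, 1⟩, ⟨0, .cup, 1⟩]) (by decide)
  have h2 := hβ.eq_of_reduces (k := 1)
    (x := [⟨1, .cap, 0⟩, ⟨1, .cup, 0⟩, ⟨1, .cap, 0⟩, ⟨1, .cup, 0⟩])
    (y := [⟨1, .cap, 0⟩, ⟨1, .cup, 0⟩]) (by decide)
  have h3 := hβ.eq_of_reduces (k := 0)
    (x := [⟨0, .cap, 1⟩, ⟨0, .cup, 1⟩, ⟨1, .cap, 0⟩, ⟨1, .cup, 0⟩, ⟨0, .cap, 1⟩, ⟨0, .cup, 1⟩])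
    (y := [⟨0, .cap, 1⟩, ⟨0, .cup, 1⟩]) (by decide)
  have h4 := hβ.eq_of_reduces (k := 0)
    (x := [⟨1, .cap, 0⟩, ⟨1, .cup, 0⟩, ⟨0, .cap, 1⟩, ⟨0, .cup, 1⟩, ⟨1, .cap, 0⟩, ⟨1, .cup, 0⟩])
    (y := [⟨1, .cap, 0⟩, ⟨1, .cup, 0⟩]) (by decide)
  have hT := T_one_mul_T_neg_one
  have hd := loopValue_eq
  cases a <;> cases b <;> cases c <;> simp only [ne_eq, not_true_eq_false, reduceCtorEq,
      not_false_eq_true, forall_const, imp_false] at ha hb hc h <;>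
    simp only [triangle, triangle', cr, evalStates_nil, evalStates_pos, evalStates_neg,
      h1, h2, h3, h4] <;> grind

theorem skeinEquiv_virtualMove_one_cap :
    SkeinEquiv 2 0 [cr 0 .virt 0, ⟨0, .cap, 0⟩] [⟨0, .cap, 0⟩] :=
  skeinEquiv_of_reduces (by decide) (by simp [cr, evalStates_nil, evalStates_cap, evalStates_virt])
    (by simp [evalStates_nil, evalStates_cap])

theorem skeinEquiv_virtualMove_one_cup :
    SkeinEquiv 0 2 [⟨0, .cup, 0⟩, cr 0 .virt 0] [⟨0, .cup, 0⟩] :=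
  skeinEquiv_of_reduces (by decide) (by simp [cr, evalStates_nil, evalStates_cup, evalStates_virt])
    (by simp [evalStates_nil, evalStates_cup])

theorem skeinEquiv_virtualMove_three :
    SkeinEquiv 3 3 (triangle .virt .virt .virt) (triangle' .virt .virt .virt) :=
  skeinEquiv_of_reduces (by decide) (by simp [triangle, cr, evalStates_nil, evalStates_virt])
    (by simp [triangle', cr, evalStates_nil, evalStates_virt])

theorem skeinEquiv_mixed_first (c : Crossing) :
    SkeinEquiv 3 3 (triangle c .virt .virt) (triangle' c .virt .virt) := by
  refine ⟨by cases c <;> decide, by cases c <;> decide, fun β hβ => ?_⟩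
  have h1 := hβ.eq_of_reduces (k := 0)
    (x := [⟨0, .cap, 1⟩, ⟨0, .cup, 1⟩, ⟨1, .crossing .virt, 0⟩, ⟨0, .crossing .virt, 1⟩])
    (y := [⟨1, .crossing .virt, 0⟩, ⟨0, .crossing .virt, 1⟩, ⟨1, .cap, 0⟩, ⟨1, .cup, 0⟩])
    (by decide)
  have h2 := hβ.eq_of_reduces (k := 0) (x := triangle .virt .virt .virt)
    (y := triangle' .virt .virt .virt) (by decide)
  simp only [triangle, triangle', cr] at h2
  cases c <;> simp [triangle, triangle', cr, evalStates_nil, evalStates_pos, evalStates_neg,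
    evalStates_virt, h1, h2]

theorem skeinEquiv_mixed_middle (c : Crossing) :
    SkeinEquiv 3 3 (triangle .virt c .virt) (triangle' .virt c .virt) := by
  refine ⟨by cases c <;> decide, by cases c <;> decide, fun β hβ => ?_⟩
  have h1 := hβ.eq_of_reduces (k := 0)
    (x := [⟨0, .crossing .virt, 1⟩, ⟨1, .cap, 0⟩, ⟨1, .cup, 0⟩, ⟨0, .crossing .virt, 1⟩])
    (y := [⟨1, .crossing .virt, 0⟩, ⟨0, .cap, 1⟩, ⟨0, .cup, 1⟩, ⟨1, .crossing .virt, 0⟩])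
    (by decide)
  have h2 := hβ.eq_of_reduces (k := 0) (x := triangle .virt .virt .virt)
    (y := triangle' .virt .virt .virt) (by decide)
  have h3 := hβ.eq_of_reduces (k := 0) (x := [⟨0, .crossing .virt, 1⟩, ⟨0, .crossing .virt, 1⟩])
    (y := [⟨1, .crossing .virt, 0⟩, ⟨1, .crossing .virt, 0⟩]) (by decide)
  simp only [triangle, triangle', cr] at h2
  cases c <;> simp [triangle, triangle', cr, evalStates_nil, evalStates_pos, evalStates_neg,
    evalStates_virt, h1, h2, h3]

theorem skeinEquiv_mixed_last (c : Crossing) :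
    SkeinEquiv 3 3 (triangle .virt .virt c) (triangle' .virt .virt c) := by
  refine ⟨by cases c <;> decide, by cases c <;> decide, fun β hβ => ?_⟩
  have h1 := hβ.eq_of_reduces (k := 0)
    (x := [⟨0, .crossing .virt, 1⟩, ⟨1, .crossing .virt, 0⟩, ⟨0, .cap, 1⟩, ⟨0, .cup, 1⟩])
    (y := [⟨1, .cap, 0⟩, ⟨1, .cup, 0⟩, ⟨0, .crossing .virt, 1⟩, ⟨1, .crossing .virt, 0⟩])
    (by decide)
  have h2 := hβ.eq_of_reduces (k := 0) (x := triangle .virt .virt .virt)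
    (y := triangle' .virt .virt .virt) (by decide)
  simp only [triangle, triangle', cr] at h2
  cases c <;> simp [triangle, triangle', cr, evalStates_nil, evalStates_pos, evalStates_neg,
    evalStates_virt, h1, h2]

/-! ### Flypes -/

theorem SkeinEquiv.symm {a b : ℕ} {l r : List Slice} (h : SkeinEquiv a b l r) :
    SkeinEquiv a b r l := ⟨h.2.1, h.1, fun β hβ => (h.2.2 β hβ).symm⟩

theorem SkeinEquiv.trans {a b : ℕ} {l m r : List Slice} (h : SkeinEquiv a b l m)
    (h' : SkeinEquiv a b m r) : SkeinEquiv a b l r :=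
  ⟨h.1, h'.2.1, fun β hβ => (h.2.2 β hβ).trans (h'.2.2 β hβ)⟩

theorem transfer_virt {x : List Bool} (hx : x.length = 2) :
    transfer [⟨0, .crossing .virt, 0⟩] x = {x.reverse} := by
  obtain ⟨p, q, rfl⟩ := List.length_eq_two.1 hx
  revert p q
  decide

/-- A crossing passes from the left of a four-ended tangle to its right while the tangle is turned
upside down. -/
theorem skeinEquiv_flype_pass (c : Crossing) {p : List Slice} (hp : IsWord 2 2 p) :
    SkeinEquiv 2 2 (cr 0 c 0 :: p) (flip p ++ [cr 0 c 0]) := by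
  have hcr : IsWord 2 2 [cr 0 c 0] := by cases c <;> decide
  refine ⟨⟨by cases c <;> rfl, hp⟩, isWord_append.2 ⟨2, isWord_flip hp, hcr⟩, fun β hβ => ?_⟩
  have hturns : IsWord 2 2 turns := by decide
  have h1 : evalStates (fun x => β (flip x)) p = evalStates β p :=
    evalStates_congr hp fun x hx =>
      hβ.eq_of_transfer_eq (isWord_flip hx) hx fun _ => transfer_flip_eq hx
  have h2 : evalStates (fun x => β (flip x ++ turns)) p = evalStates (fun x => β (turns ++ x)) p :=
    evalStates_congr hp fun x hx =>
      hβ.eq_of_transfer_eq (isWord_append.2 ⟨2, isWord_flip hx, hturns⟩)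
        (isWord_append.2 ⟨2, hturns, hx⟩) fun d hd => by
        rw [transfer_turns_comm hx hd, transfer_append, transfer_append, transfer_flip_eq hx hd]
  have h3 : evalStates (fun x => β (flip x ++ [⟨0, .crossing .virt, 0⟩])) p =
      evalStates (fun x => β (⟨0, .crossing .virt, 0⟩ :: x)) p :=
    evalStates_congr hp fun x hx =>
      hβ.eq_of_transfer_eq (isWord_append.2 ⟨2, isWord_flip hx, by decide⟩)
        ⟨rfl, hx⟩ fun d hd => by
        have hd' : d.reverse.length = 2 := by simp [hd]
        rw [transfer_append, ← List.singleton_append (l := x), transfer_append, transfer_virt hd,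
          Multiset.singleton_bind]
        have h := transfer_flip hx hd'
        rw [List.reverse_reverse] at h
        rw [h, Multiset.bind_map, Multiset.bind_congr fun z hz => transfer_virt
          (x := z.reverse) (by simp [length_of_mem_transfer hx hd' hz])]
        simp only [List.reverse_reverse]
        exact (Multiset.bind_singleton _ _).trans (Multiset.map_id' _)
  simp only [turns, List.cons_append, List.nil_append] at h2
  rw [evalStates_append, evalStates_flip]
  cases c <;> simp only [cr, evalStates_pos, evalStates_neg, evalStates_virt, evalStates_nil,
    evalStates_add, evalStates_mul_left, List.append_nil, h1, h2, h3]

theorem flip_flip (w : List Slice) : flip (flip w) = w := by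
  simp [flip, Function.comp_def]

/-- The form of the flype that adds two opposite crossings. -/
theorem skeinEquiv_flype (c : Crossing) {p : List Slice} (hp : IsWord 2 2 p) :
    SkeinEquiv 2 2 p (cr 0 c 0 :: (flip p ++ [cr 0 c.opp 0])) := by
  have hpad : ∀ w, pad 0 0 w = w := fun w => by simp [pad]
  have hc : IsWord 2 2 [cr 0 c.opp 0] := by cases c <;> decide
  -- Moving the first crossing back through the tangle brings it next to the opposite crossing.
  have h1 := (skeinEquiv_flype_pass c (isWord_flip hp)).context (i := 0) (j := 0) (m := 2)
    (u := []) rfl hc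
  have h2 := (skeinEquiv_two c).context (i := 0) (j := 0) (n := 2) (v := []) hp rfl
  simp only [hpad, flip_flip, List.nil_append, List.append_nil] at h1 h2
  refine SkeinEquiv.symm (SkeinEquiv.trans ?_ h2)
  simpa using h1

/-! ### Invariance of the bracket -/

open Classical in
/-- The coefficient of a basic tangle in a tangle without classical crossings. -/
noncomputable def coefficient (m n : ℕ) (σ : Setoid (Fin m ⊕ Fin n)) (x : List Slice) :
    LaurentPolynomial ℤ :=
  if connection m n x = σ then loopValue ^ loops m n x else 0

theorem isLocal_coefficient (m n : ℕ) (σ : Setoid (Fin m ⊕ Fin n)) :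
    IsLocal m n (coefficient m n σ) := by
  intro k x y hx hy h
  obtain ⟨h1, h2⟩ := connection_eq_and_loops_eq hx hy h
  rw [coefficient, coefficient, h1, h2, mul_ite, mul_zero, pow_add, mul_comm]

theorem isLocal_loopValue_pow (m n : ℕ) : IsLocal m n fun x => loopValue ^ loops m n x := by
  intro k x y hx hy h
  simp only [(connection_eq_and_loops_eq hx hy h).2, pow_add, mul_comm]

theorem bracket_apply {m n : ℕ} (D : Diagram m n) (σ : Setoid (Fin m ⊕ Fin n)) :
    bracket D σ = evalStates (coefficient m n σ) D.word := by
  classical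
  have h : ∀ L : List (Setoid (Fin m ⊕ Fin n) →₀ LaurentPolynomial ℤ),
      L.sum σ = (L.map fun f => f σ).sum := fun L =>
    map_list_sum (Finsupp.applyAddHom σ) L
  rw [bracket, h, List.map_map, evalStates]
  congr 2
  funext x
  by_cases hx : connection m n x.2 = σ <;> simp [coefficient, hx]

theorem loops_cup_pos {x : List Slice} (hx : IsWord 0 0 (⟨0, .cup, 0⟩ :: x)) :
    0 < loops 0 0 (⟨0, .cup, 0⟩ :: x) := by
  have := finite_closedCurve hx
  have : Nonempty (ClosedCurve 0 0 (⟨0, .cup, 0⟩ :: x)) :=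
    ⟨⟨_, ⟨_, _, arc_cons.2 (.inl (.cup rfl)), rfl⟩, by rintro (e | e) <;> exact e.elim0⟩⟩
  exact Nat.card_pos

/-- On a nonempty link diagram the link bracket is the tangle bracket divided by `loopValue`. -/
theorem loopValue_mul_linkBracket {D : LinkDiagram} (hD : D.word ≠ []) :
    loopValue * linkBracket D = evalStates (fun x => loopValue ^ loops 0 0 x) D.word := by
  have hw := D.isWord
  change loopValue * evalStates (fun x => loopValue ^ (loops 0 0 x - 1)) D.word = _
  generalize D.word = w at hD hw ⊢
  rw [← evalStates_mul_left]
  match w, hD, hw with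
  | ⟨i, g, j⟩ :: w, _, hw =>
    obtain ⟨h, h'⟩ := hw
    simp only [Slice.source] at h
    obtain rfl : i = 0 := by omega
    obtain rfl : j = 0 := by omega
    obtain rfl : g = .cup := by
      cases g
      · simp [Piece.ins] at h
      · simp [Piece.ins] at h
      · rfl
    rw [evalStates_cup, evalStates_cup]
    refine evalStates_congr h' fun x hx => ?_
    rw [← pow_succ', Nat.sub_add_cancel (loops_cup_pos ⟨rfl, hx⟩)]

theorem loopValue_ne_zero : loopValue ≠ 0 := by
  intro h
  have := congrArg (fun f : LaurentPolynomial ℤ => f.coeff 2) h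
  simp [loopValue] at this

/-- Two diagrams have the same combination of states, and both or neither is the empty link
diagram. -/
def BracketEquiv {m n : ℕ} (D D' : Diagram m n) : Prop :=
  SkeinEquiv m n D.word D'.word ∧ (m = 0 → (D.word = [] ↔ D'.word = []))

theorem bracketEquiv_equivalence (m n : ℕ) : Equivalence (BracketEquiv (m := m) (n := n)) where
  refl D := ⟨⟨D.isWord, D.isWord, fun _ _ => rfl⟩, fun _ => Iff.rfl⟩
  symm h := ⟨h.1.symm, fun hm => (h.2 hm).symm⟩
  trans h h' := ⟨h.1.trans h'.1, fun hm => (h.2 hm).trans (h'.2 hm)⟩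

theorem BracketEquiv.bracket_eq {m n : ℕ} {D D' : Diagram m n} (h : BracketEquiv D D') :
    bracket D = bracket D' := by
  refine Finsupp.ext fun σ => ?_
  rw [bracket_apply, bracket_apply]
  exact h.1.2.2 _ (isLocal_coefficient m n σ)

theorem BracketEquiv.linkBracket_eq {D D' : LinkDiagram} (h : BracketEquiv D D') :
    linkBracket D = linkBracket D' := by
  by_cases hD : D.word = []
  · rw [linkBracket, linkBracket, hD, (h.2 rfl).1 hD]
  · refine mul_left_cancel₀ loopValue_ne_zero ?_
    rw [loopValue_mul_linkBracket hD, loopValue_mul_linkBracket (mt (h.2 rfl).2 hD)]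
    exact h.1.2.2 _ (isLocal_loopValue_pow 0 0)

/-- The two sides of a move: skein equivalent words that are not both empty, where an empty side
has at least one strand. -/
def IsMove (l r : List Slice) : Prop :=
  ∃ a b, SkeinEquiv a b l r ∧ (l ≠ [] ∨ r ≠ []) ∧ (l = [] ∨ r = [] → a ≠ 0)

theorem isMove_of_ne_nil {a b : ℕ} {l r : List Slice} (h : SkeinEquiv a b l r) (hl : l ≠ [])
    (hr : r ≠ []) : IsMove l r := ⟨a, b, h, .inl hl, by simp [hl, hr]⟩

theorem isMove_of_ne_zero {a b : ℕ} {l r : List Slice} (h : SkeinEquiv a b l r) (ha : a ≠ 0)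
    (hne : l ≠ [] ∨ r ≠ []) : IsMove l r := ⟨a, b, h, hne, fun _ => ha⟩

theorem bracketEquiv_of_differBy {M : List Slice → List Slice → Prop}
    (hM : ∀ l r, M l r → IsMove l r) {m n : ℕ} {D D' : Diagram m n} (h : DifferBy M D D') :
    BracketEquiv D D' := by
  obtain ⟨u, v, l, r, i, j, hlr, hD, hD'⟩ := h
  obtain ⟨a, b, hs, hne, h0⟩ := hM l r hlr
  have hpad : ∀ w : List Slice, pad i j w = [] ↔ w = [] := fun w => List.map_eq_nil_iff
  obtain ⟨hu, hv⟩ : IsWord m (i + a + j) u ∧ IsWord (i + b + j) n v := by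
    -- The nonempty one of the two words determines the number of strands on both sides.
    have key : ∀ w, w ≠ [] → IsWord a b w → IsWord m n (u ++ pad i j w ++ v) →
        IsWord m (i + a + j) u ∧ IsWord (i + b + j) n v := by
      intro w hw hab h
      obtain ⟨k', h, hv⟩ := isWord_append.1 h
      obtain ⟨k, hu, h⟩ := isWord_append.1 h
      obtain rfl := IsWord.unique_left (mt (hpad w).1 hw) h (isWord_pad hab i j)
      obtain rfl := IsWord.unique_right h (isWord_pad hab i j)
      exact ⟨hu, hv⟩
    rcases hne with hne | hne
    · exact key l hne hs.1 (hD ▸ D.isWord)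
    · exact key r hne hs.2.1 (hD' ▸ D'.isWord)
  refine ⟨?_, ?_⟩
  · rw [hD, hD']
    exact hs.context hu hv
  · rintro rfl
    rw [hD, hD']
    simp only [List.append_eq_nil_iff, hpad]
    have hu0 : u = [] → a = 0 := by
      rintro rfl
      have : 0 = i + a + j := hu
      omega
    constructor
    · rintro ⟨⟨rfl, rfl⟩, rfl⟩
      exact absurd (hu0 rfl) (h0 (.inl rfl))
    · rintro ⟨⟨rfl, rfl⟩, rfl⟩
      exact absurd (hu0 rfl) (h0 (.inr rfl))

theorem isMove_planarIsotopyMove (l r : List Slice) (h : PlanarIsotopyMove l r) :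
    IsMove l r := by
  cases h with
  | exchange g h k => exact isMove_of_ne_nil (skeinEquiv_exchange g h k) (by simp) (by simp)
  | zigzag_up => exact isMove_of_ne_zero skeinEquiv_zigzag_up one_ne_zero (by simp)
  | zigzag_down => exact isMove_of_ne_zero skeinEquiv_zigzag_down one_ne_zero (by simp)
  | slide_cap c => exact isMove_of_ne_nil (skeinEquiv_slide_cap c) (by simp) (by simp)
  | slide_cup c => exact isMove_of_ne_nil (skeinEquiv_slide_cup c) (by simp) (by simp)

theorem isMove_regularMove (l r : List Slice) (h : RegularMove l r) : IsMove l r := by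
  cases h with
  | two c => exact isMove_of_ne_zero (skeinEquiv_two c) two_ne_zero (by simp)
  | three a b c ha hb hc h =>
    exact isMove_of_ne_zero (skeinEquiv_three ha hb hc h) three_ne_zero (by simp [triangle])

theorem isMove_virtualMove (l r : List Slice) (h : VirtualMove l r) : IsMove l r := by
  cases h with
  | one_cap => exact isMove_of_ne_nil skeinEquiv_virtualMove_one_cap (by simp) (by simp)
  | one_cup => exact isMove_of_ne_nil skeinEquiv_virtualMove_one_cup (by simp) (by simp)
  | two => exact isMove_of_ne_zero (skeinEquiv_two .virt) two_ne_zero (by simp)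
  | three =>
    exact isMove_of_ne_zero skeinEquiv_virtualMove_three three_ne_zero (by simp [triangle])
  | mixed_first c =>
    exact isMove_of_ne_zero (skeinEquiv_mixed_first c) three_ne_zero (by simp [triangle])
  | mixed_middle c =>
    exact isMove_of_ne_zero (skeinEquiv_mixed_middle c) three_ne_zero (by simp [triangle])
  | mixed_last c =>
    exact isMove_of_ne_zero (skeinEquiv_mixed_last c) three_ne_zero (by simp [triangle])

theorem isMove_flypeMove (l r : List Slice) (h : FlypeMove l r) : IsMove l r := by
  cases h with
  | classical c hc p hp => exact isMove_of_ne_zero (skeinEquiv_flype c hp) two_ne_zero (by simp)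
  | classical_pass c hc p hp =>
    exact isMove_of_ne_zero (skeinEquiv_flype_pass c hp) two_ne_zero (by simp)
  | virtual p hp =>
    exact isMove_of_ne_zero (skeinEquiv_flype .virt hp) two_ne_zero (by simp)
  | virtual_pass p hp =>
    exact isMove_of_ne_zero (skeinEquiv_flype_pass .virt hp) two_ne_zero (by simp)

theorem bracketEquiv_of_eqvGen {m n : ℕ} {r : Diagram m n → Diagram m n → Prop}
    (hr : ∀ D D', r D D' → BracketEquiv D D') {D D' : Diagram m n}
    (h : Relation.EqvGen r D D') : BracketEquiv D D' :=
  (bracketEquiv_equivalence m n).eqvGen_iff.1 (h.mono hr)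

theorem Flype.bracketEquiv {m n : ℕ} {D D' : Diagram m n} (h : Flype D D') :
    BracketEquiv D D' := by
  obtain ⟨E, E', h1, h2, h3⟩ := h
  have hiso : ∀ D D' : Diagram m n, PlanarIsotopic D D' → BracketEquiv D D' := fun _ _ =>
    bracketEquiv_of_eqvGen fun _ _ => bracketEquiv_of_differBy isMove_planarIsotopyMove
  exact (bracketEquiv_equivalence m n).trans (hiso _ _ h1) <|
    (bracketEquiv_equivalence m n).trans (bracketEquiv_of_differBy isMove_flypeMove h2)
      (hiso _ _ h3)

theorem RegularFEquivalent.bracketEquiv {m n : ℕ} {D D' : Diagram m n}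
    (h : RegularFEquivalent D D') : BracketEquiv D D' := by
  refine bracketEquiv_of_eqvGen (fun D D' h => ?_) h
  rcases h with h | h | h | h
  · exact bracketEquiv_of_differBy isMove_planarIsotopyMove h
  · exact bracketEquiv_of_differBy isMove_regularMove h
  · exact bracketEquiv_of_differBy isMove_virtualMove h
  · exact h.bracketEquiv

end VirtualTangle

theorem mainTheorem1 :
    (∀ (m n : ℕ) (D D' : VirtualTangle.Diagram m n),
      VirtualTangle.Flype D D' → VirtualTangle.bracket D = VirtualTangle.bracket D') ∧
    (∀ D D' : VirtualTangle.LinkDiagram,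
      VirtualTangle.Flype D D' → VirtualTangle.linkBracket D = VirtualTangle.linkBracket D') ∧
    (∀ (m n : ℕ) (D D' : VirtualTangle.Diagram m n),
      VirtualTangle.RegularFEquivalent D D' →
        VirtualTangle.bracket D = VirtualTangle.bracket D') ∧
    (∀ D D' : VirtualTangle.LinkDiagram,
      VirtualTangle.RegularFEquivalent D D' →
        VirtualTangle.linkBracket D = VirtualTangle.linkBracket D') :=
  ⟨fun _ _ _ _ h => h.bracketEquiv.bracket_eq, fun _ _ h => h.bracketEquiv.linkBracket_eq,
    fun _ _ _ _ h => h.bracketEquiv.bracket_eq, fun _ _ h => h.bracketEquiv.linkBracket_eq⟩
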